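/- A stable matching instance $A$ consists of $n$ boys and $n$ girls, each with a complete strict preference list of the agents of the other sex; a matching is a bijection between boys and girls, a pair $bg$ blocks $M$ if $b$ and $g$ strictly prefer each other to their partners in $M$, and $M$ is stable if no pair blocks it. An (upward) shift moves one entry of the list of one agent (a girl or a boy) to a higher position of this list, keeping the order of all other entries; let $B$ be the resulting instance and let $\mathcal M_{AB}$ be the set of matchings that are stable for $A$ but not for $B$. For a stable matching $M$ of $A$ and a boy $b$, let $s_M(b)$ be the first girl on $b$'s list who strictly prefers $b$ to her $M$-partner (if there is one), and let $next_M(b)$ be the $M$-partner of $s_M(b)$. A rotation exposed in $M$ is a nonempty list $\rho=(b_0g_0,\dots,b_{r-1}g_{r-1})$ of distinct pairs of $M$ such that $b_{i+1}=next_M(b_i)$ for all $i$ (indices modulo $r$); lists that differ by a cyclic shift represent the same rotation. The matching $M/\rho$ matches each $b_i$ to $g_{i+1}$ and agrees with $M$ on all other boys. The rotation $\rho$ goes into $\mathcal M_{AB}$ if it is exposed in some stable matching $M$ of $A$ with $M\notin\mathcal M_{AB}$ and $M/\rho\in\mathcal M_{AB}$; it goes out of $\mathcal M_{AB}$ if it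 is exposed in some $M\in\mathcal M_{AB}$ with $M/\rho\notin\mathcal M_{AB}$. **Proposition.** For every instance $A$ and every shift there are at most one rotation $\rho_{\mathrm{in}}$ that goes into $\mathcal M_{AB}$ and at most one rotation $\rho_{\mathrm{out}}$ that goes out of $\mathcal M_{AB}$. Moreover, there is an algorithm that, given $A$ and the shift, outputs $\rho_{\mathrm{in}}$ and $\rho_{\mathrm{out}}$ (or reports for each of them that it does not exist) in time polynomial in $n$. Here an algorithm is a program of a random access machine whose elementary instructions (loading constants, addition, truncated subtraction, direct and indirect copying between registers and memory, comparison of registers) take one step each. -/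

import Mathlib

/-! ### Random access machines with unit cost -/

namespace RAM

/-- A configuration of the machine: registers and an addressable memory, both holding natural
numbers. -/
structure State where
  reg : ℕ → ℕ
  mem : ℕ → ℕ

/-- Programs of a random access machine in structured form. A program is a finite object; it
mentions finitely many registers and constants. The only arithmetic is addition and truncated
subtraction, so that the bit length of the numbers grows by at most one per step, and unit-cost
time is polynomially equivalent to Turing machine time. -/
inductive Prog : Type where
  /-- do nothing -/
  | skip : Prog
  /-- `reg x := k` -/
  | const (x k : ℕ) : Prog
  /-- `reg x := reg y + reg z` -/
  | add (x y z : ℕ) : Prog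
  /-- `reg x := reg y - reg z` (truncated) -/
  | sub (x y z : ℕ) : Prog
  /-- `reg x := mem (reg y)` -/
  | load (x y : ℕ) : Prog
  /-- `mem (reg x) := reg y` -/
  | store (x y : ℕ) : Prog
  /-- run `p`, then `q` -/
  | seq (p q : Prog) : Prog
  /-- if `reg x < reg y` then run `p`, else run `q` -/
  | branch (x y : ℕ) (p q : Prog) : Prog
  /-- while `reg x < reg y` run `p` -/
  | loop (x y : ℕ) (p : Prog) : Prog

namespace State

/-- Overwrite register `x` by `v`. -/
def setReg (σ : State) (x v : ℕ) : State := ⟨Function.update σ.reg x v, σ.mem⟩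

/-- Overwrite memory cell `a` by `v`. -/
def setMem (σ : State) (a v : ℕ) : State := ⟨σ.reg, Function.update σ.mem a v⟩

/-- The initial state on an input word: the word stands in the memory cells `0, 1, 2, …`, all other
cells and all registers are zero. -/
def init (w : List ℕ) : State := ⟨fun _ => 0, fun a => w.getD a 0⟩

/-- The word `w` stands in the memory cells `0, …, w.length - 1`. -/
def Holds (σ : State) (w : List ℕ) : Prop := ∀ (a : ℕ) (h : a < w.length), σ.mem a = w[a]

end State

/-- `Exec p σ t τ`: started in state `σ`, the program `p` halts in state `τ` after exactly `t`
steps. Every elementary instruction and every evaluation of a test counts as one step. -/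
inductive Exec : Prog → State → ℕ → State → Prop where
  | skip (σ : State) : Exec .skip σ 1 σ
  | const (σ : State) (x k : ℕ) : Exec (.const x k) σ 1 (σ.setReg x k)
  | add (σ : State) (x y z : ℕ) : Exec (.add x y z) σ 1 (σ.setReg x (σ.reg y + σ.reg z))
  | sub (σ : State) (x y z : ℕ) : Exec (.sub x y z) σ 1 (σ.setReg x (σ.reg y - σ.reg z))
  | load (σ : State) (x y : ℕ) : Exec (.load x y) σ 1 (σ.setReg x (σ.mem (σ.reg y)))
  | store (σ : State) (x y : ℕ) : Exec (.store x y) σ 1 (σ.setMem (σ.reg x) (σ.reg y))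
  | seq {p q : Prog} {σ τ υ : State} {s t : ℕ} (hp : Exec p σ s τ) (hq : Exec q τ t υ) :
      Exec (.seq p q) σ (s + t) υ
  | branch_true {x y : ℕ} {p q : Prog} {σ τ : State} {t : ℕ} (h : σ.reg x < σ.reg y)
      (hp : Exec p σ t τ) : Exec (.branch x y p q) σ (t + 1) τ
  | branch_false {x y : ℕ} {p q : Prog} {σ τ : State} {t : ℕ} (h : ¬ σ.reg x < σ.reg y)
      (hq : Exec q σ t τ) : Exec (.branch x y p q) σ (t + 1) τ
  | loop_true {x y : ℕ} {p : Prog} {σ τ υ : State} {s t : ℕ} (h : σ.reg x < σ.reg y)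
      (hp : Exec p σ s τ) (hl : Exec (.loop x y p) τ t υ) :
      Exec (.loop x y p) σ (s + t + 1) υ
  | loop_false {x y : ℕ} {p : Prog} {σ : State} (h : ¬ σ.reg x < σ.reg y) :
      Exec (.loop x y p) σ 1 σ

end RAM

/-! ### Stable matchings, shifts and rotations -/

namespace StableMatching

/-- An instance of the stable matching problem with `n` boys, `n` girls and complete strict
preference lists: `boyList b k` is the girl in position `k` of the list of boy `b`, and
`girlList g k` is the boy in position `k` of the list of girl `g`; position `0` is the most
preferred one. -/
structure SMInstance (n : ℕ) where
  boyList : Fin n → Equiv.Perm (Fin n)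
  girlList : Fin n → Equiv.Perm (Fin n)

/-- A (perfect) matching: `M b` is the partner of boy `b`, and `M.symm g` that of girl `g`. -/
abbrev Matching (n : ℕ) := Fin n ≃ Fin n

namespace SMInstance

variable {n : ℕ}

/-- Boy `b` strictly prefers girl `g` to girl `g'`. -/
def BoyPrefers (A : SMInstance n) (b g g' : Fin n) : Prop :=
  (A.boyList b).symm g < (A.boyList b).symm g'

/-- Girl `g` strictly prefers boy `b` to boy `b'`. -/
def GirlPrefers (A : SMInstance n) (g b b' : Fin n) : Prop :=
  (A.girlList g).symm b < (A.girlList g).symm b'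

/-- Boy `b` and girl `g` prefer each other to their partners in `M`. -/
def Blocks (A : SMInstance n) (M : Matching n) (b g : Fin n) : Prop :=
  A.BoyPrefers b g (M b) ∧ A.GirlPrefers g b (M.symm g)

/-- The set of stable matchings of `A`. -/
def stableMatchings (A : SMInstance n) : Set (Matching n) :=
  {M | ∀ b g, ¬ A.Blocks M b g}

end SMInstance

/-- An upward shift: in the list of one girl or of one boy, the entry in position `j` is moved up to
position `i < j`, and the entries in positions `i, …, j - 1` move down by one. -/
inductive Shift (n : ℕ) : Type where
  | girl (g i j : Fin n) (h : i < j) : Shift n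
  | boy (b i j : Fin n) (h : i < j) : Shift n

/-- Move the entry in position `j` of a list up to position `i`. The permutation `Fin.cycleIcc i j`
is the cycle `i ↦ i + 1 ↦ ⋯ ↦ j ↦ i`, and it sends the old position of an entry, other than that in
position `j`, to its new one. -/
def shiftList {n : ℕ} (L : Equiv.Perm (Fin n)) (i j : Fin n) : Equiv.Perm (Fin n) :=
  (Fin.cycleIcc i j).symm.trans L

/-- The instance that results from `A` by a shift. -/
def SMInstance.applyShift {n : ℕ} (A : SMInstance n) : Shift n → SMInstance n
  | .girl g i j _ => ⟨A.boyList, Function.update A.girlList g (shiftList (A.girlList g) i j)⟩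
  | .boy b i j _ => ⟨Function.update A.boyList b (shiftList (A.boyList b) i j), A.girlList⟩

/-- The set of stable matchings of `A` that are not stable for `B`. -/
def lostMatchings {n : ℕ} (A B : SMInstance n) : Set (Matching n) :=
  A.stableMatchings \ B.stableMatchings

namespace SMInstance

variable {n : ℕ}

/-- `g` is the first girl on the list of `b` who strictly prefers `b` to her partner in `M`. -/
def IsFirstWilling (A : SMInstance n) (M : Matching n) (b g : Fin n) : Prop :=
  A.GirlPrefers g b (M.symm g) ∧
    ∀ g', A.BoyPrefers b g' g → ¬ A.GirlPrefers g' b (M.symm g')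

/-- `b'` is the partner in `M` of the first girl on the list of `b` who strictly prefers `b` to her
partner in `M`. -/
def IsNext (A : SMInstance n) (M : Matching n) (b b' : Fin n) : Prop :=
  ∃ g, A.IsFirstWilling M b g ∧ M.symm g = b'

/-- The nonempty list `ρ = [(b₀, g₀), …, (b_{r-1}, g_{r-1})]` of distinct pairs of the stable
matching `M` is a rotation exposed in `M`: `b_{i+1}` is the successor of `b_i` in the sense of
`IsNext` for every `i`, with `i + 1` taken modulo `r`. -/
def IsExposed (A : SMInstance n) (M : Matching n) (ρ : List (Fin n × Fin n)) : Prop :=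
  M ∈ A.stableMatchings ∧ ρ ≠ [] ∧ ρ.Nodup ∧ (∀ p ∈ ρ, M p.1 = p.2) ∧
    ∀ (i : ℕ) (h : i < ρ.length),
      A.IsNext M ρ[i].1 (ρ[(i + 1) % ρ.length]'(Nat.mod_lt _ (Nat.zero_lt_of_lt h))).1

end SMInstance

/-- The elimination `M / ρ`: boys that do not occur in `ρ = [(b₀, g₀), …, (b_{r-1}, g_{r-1})]` keep
their partner, and `b_i` gets the girl `g_{i+1} = M b_{i+1}`, with `i + 1` taken modulo `r`
(`List.formPerm` of the list of the boys is the cycle `b_i ↦ b_{i+1}`). -/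
def eliminate {n : ℕ} (M : Matching n) (ρ : List (Fin n × Fin n)) : Matching n :=
  (ρ.map Prod.fst).formPerm.trans M

/-- The rotations of `A` that go into the set `S` of stable matchings. -/
def rotationsInto {n : ℕ} (A : SMInstance n) (S : Set (Matching n)) :
    Set (List (Fin n × Fin n)) :=
  {ρ | ∃ M, A.IsExposed M ρ ∧ M ∉ S ∧ eliminate M ρ ∈ S}

/-- The rotations of `A` that go out of the set `S` of stable matchings. -/
def rotationsOutOf {n : ℕ} (A : SMInstance n) (S : Set (Matching n)) :
    Set (List (Fin n × Fin n)) :=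
  {ρ | ∃ M, A.IsExposed M ρ ∧ M ∈ S ∧ eliminate M ρ ∉ S}

/-- `o` is the only rotation in the set `R`, where lists that differ by a cyclic shift represent the
same rotation; `o = none` if `R` is empty. -/
def IsTheRotationOf {n : ℕ} (R : Set (List (Fin n × Fin n))) :
    Option (List (Fin n × Fin n)) → Prop
  | none => R = ∅
  | some ρ => ∀ ρ', ρ' ∈ R ↔ ρ' ~r ρ

/-! ### Input and output words -/

/-- A shift as a word: side (`0` for a girl's list, `1` for a boy's list), agent, new position,
old position. -/
def Shift.encode {n : ℕ} : Shift n → List ℕ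
  | .girl g i j _ => [0, g, i, j]
  | .boy b i j _ => [1, b, i, j]

/-- The input word: `n`, the shift, the lists of the boys `0, …, n - 1` one after the other, and
likewise those of the girls; `k.divNat` and `k.modNat` are quotient and remainder of `k` by `n`. -/
def encodeInput {n : ℕ} (A : SMInstance n) (s : Shift n) : List ℕ :=
  n :: (s.encode
    ++ List.ofFn (fun k : Fin (n * n) => (A.boyList k.divNat k.modNat : ℕ))
    ++ List.ofFn (fun k : Fin (n * n) => (A.girlList k.divNat k.modNat : ℕ)))

/-- A rotation (or its absence) as a word: the number `r` of pairs, then `b₀, g₀, …,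
b_{r-1}, g_{r-1}`; absence is the word `0`. -/
def encodeRotation {n : ℕ} : Option (List (Fin n × Fin n)) → List ℕ
  | none => [0]
  | some ρ => ρ.length :: ρ.flatMap (fun p => [(p.1 : ℕ), (p.2 : ℕ)])

end StableMatching

/-! ### A language of bounded loops and its compiler -/

namespace RAM

open Polynomial

/-- Arithmetic expressions; `size` is the bound `n` of all sums and loops. -/
inductive Expr : Type where
  | const (k : ℕ) : Expr
  | size : Expr
  | var (x : ℕ) : Expr
  | add (a b : Expr) : Expr
  | mem (a : Expr) : Expr
  /-- the sum of the values of `a` for `x = 0, …, n - 1` -/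
  | sum (x : ℕ) (a : Expr) : Expr
  /-- if `a < b` then `c` else `d` -/
  | ite (a b c d : Expr) : Expr

/-- Statements; `loop x s` runs `s` for `x = 0, …, n - 1` and then clears `x`. -/
inductive Stmt : Type where
  | skip : Stmt
  | assign (x : ℕ) (a : Expr) : Stmt
  | store (a b : Expr) : Stmt
  | seq (s t : Stmt) : Stmt
  | ite (a b : Expr) (s t : Stmt) : Stmt
  | loop (x : ℕ) (s : Stmt) : Stmt

/-- The value of an expression in a state whose registers are the variables. -/
def Expr.eval (n : ℕ) : Expr → State → ℕ
  | const k, _ => k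
  | size, _ => n
  | var x, σ => σ.reg x
  | add a b, σ => a.eval n σ + b.eval n σ
  | mem a, σ => σ.mem (a.eval n σ)
  | sum x a, σ => ∑ i ∈ Finset.range n, a.eval n (σ.setReg x i)
  | ite a b c d, σ => if a.eval n σ < b.eval n σ then c.eval n σ else d.eval n σ

/-- The effect of a statement. -/
def Stmt.run (n : ℕ) : Stmt → State → State
  | skip, σ => σ
  | assign x a, σ => σ.setReg x (a.eval n σ)
  | store a b, σ => σ.setMem (a.eval n σ) (b.eval n σ)
  | seq s t, σ => t.run n (s.run n σ)
  | ite a b s t, σ => if a.eval n σ < b.eval n σ then s.run n σ else t.run n σ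
  | loop x s, σ => (Nat.rec σ (fun i τ => s.run n (τ.setReg x i)) n : State).setReg x 0

/-- A bound for the time to evaluate an expression, as a polynomial in `n`. -/
noncomputable def Expr.cost : Expr → ℕ[X]
  | const _ => 1
  | size => 2
  | var _ => 2
  | add a b => a.cost + b.cost + 1
  | mem a => a.cost + 1
  | sum _ a => X * (a.cost + 4) + 7
  | ite a b c d => a.cost + b.cost + c.cost + d.cost + 1

/-- A bound for the time to run a statement, as a polynomial in `n`. -/
noncomputable def Stmt.cost : Stmt → ℕ[X]
  | skip => 1
  | assign _ a => a.cost + 2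
  | store a b => a.cost + b.cost + 1
  | seq s t => s.cost + t.cost
  | ite a b s t => a.cost + b.cost + s.cost + t.cost + 1
  | loop _ s => X * (s.cost + 5) + 3

/-- Code that evaluates an expression into register `3 * t + 2`. The variable `x` is held in
register `3 * x`, and `n` in register `1`. -/
def Expr.compile : Expr → ℕ → Prog
  | const k, t => .const (3 * t + 2) k
  | size, t => .seq (.const (3 * t + 2) 0) (.add (3 * t + 2) 1 (3 * t + 2))
  | var x, t => .seq (.const (3 * t + 2) 0) (.add (3 * t + 2) (3 * x) (3 * t + 2))
  | add a b, t =>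
    .seq (a.compile t) (.seq (b.compile (t + 1)) (.add (3 * t + 2) (3 * t + 2) (3 * (t + 1) + 2)))
  | mem a, t => .seq (a.compile t) (.load (3 * t + 2) (3 * t + 2))
  | sum x a, t =>
    .seq (.const (3 * (t + 2) + 2) 0)
      (.seq (.add (3 * (t + 1) + 2) (3 * x) (3 * (t + 2) + 2))
      (.seq (.const (3 * t + 2) 0)
      (.seq (.const (3 * x) 0)
      (.seq (.loop (3 * x) 1
        (.seq (a.compile (t + 2))
        (.seq (.add (3 * t + 2) (3 * t + 2) (3 * (t + 2) + 2))
        (.seq (.const (3 * (t + 2) + 2) 1)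
          (.add (3 * x) (3 * x) (3 * (t + 2) + 2))))))
      (.seq (.const (3 * (t + 2) + 2) 0)
        (.add (3 * x) (3 * (t + 1) + 2) (3 * (t + 2) + 2)))))))
  | ite a b c d, t =>
    .seq (a.compile t) (.seq (b.compile (t + 1))
      (.branch (3 * t + 2) (3 * (t + 1) + 2) (c.compile t) (d.compile t)))

/-- Code that runs a statement; loop counters are held in the registers `3 * d + 4`. -/
def Stmt.compile : Stmt → ℕ → Prog
  | skip, _ => .skip
  | assign x a, _ =>
    .seq (a.compile 0) (.seq (.const 5 0) (.add (3 * x) 2 5))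
  | store a b, _ => .seq (a.compile 0) (.seq (b.compile 1) (.store 2 5))
  | seq s t, d => .seq (s.compile d) (t.compile d)
  | ite a b s t, d =>
    .seq (a.compile 0) (.seq (b.compile 1) (.branch 2 5 (s.compile d) (t.compile d)))
  | loop x s, d =>
    .seq (.const (3 * d + 4) 0)
      (.seq (.loop (3 * d + 4) 1
        (.seq (.const 2 0)
        (.seq (.add (3 * x) (3 * d + 4) 2)
        (.seq (s.compile (d + 1))
        (.seq (.const 2 1)
          (.add (3 * d + 4) (3 * d + 4) 2))))))
      (.const (3 * x) 0))

/-- The state of the variables that is held in a state of the machine. -/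
def State.view (σ : State) : State := ⟨fun x => σ.reg (3 * x), σ.mem⟩

/-- Running `p` takes at most `T` steps and leads to a state with property `Q`. -/
def Runs (p : Prog) (σ : State) (T : ℕ) (Q : State → Prop) : Prop :=
  ∃ t τ, Exec p σ t τ ∧ t ≤ T ∧ Q τ

section Rules

variable {p q : Prog} {σ : State} {S T U : ℕ} {Q R : State → Prop}

theorem Runs.mono (h : Runs p σ S Q) (hT : S ≤ T) (hQ : ∀ τ, Q τ → R τ) : Runs p σ T R :=
  let ⟨t, τ, he, ht, hq⟩ := h
  ⟨t, τ, he, ht.trans hT, hQ τ hq⟩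

theorem Runs.seq (hp : Runs p σ S Q) (hq : ∀ τ, Q τ → Runs q τ T R) (hU : S + T ≤ U) :
    Runs (.seq p q) σ U R := by
  obtain ⟨s, τ, he, hs, hτ⟩ := hp
  obtain ⟨t, υ, he', ht, hυ⟩ := hq τ hτ
  exact ⟨_, υ, .seq he he', by omega, hυ⟩

theorem Runs.const {x k : ℕ} (h : Q (σ.setReg x k)) : Runs (.const x k) σ 1 Q :=
  ⟨1, _, .const σ x k, le_rfl, h⟩

theorem Runs.add {x y z : ℕ} (h : Q (σ.setReg x (σ.reg y + σ.reg z))) :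
    Runs (.add x y z) σ 1 Q :=
  ⟨1, _, .add σ x y z, le_rfl, h⟩

theorem Runs.load {x y : ℕ} (h : Q (σ.setReg x (σ.mem (σ.reg y)))) : Runs (.load x y) σ 1 Q :=
  ⟨1, _, .load σ x y, le_rfl, h⟩

theorem Runs.store {x y : ℕ} (h : Q (σ.setMem (σ.reg x) (σ.reg y))) : Runs (.store x y) σ 1 Q :=
  ⟨1, _, .store σ x y, le_rfl, h⟩

theorem Runs.constSeq {x k : ℕ} (h : Runs q (σ.setReg x k) T R) :
    Runs (.seq (.const x k) q) σ (T + 1) R :=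
  Runs.seq (Q := fun τ => τ = σ.setReg x k) (.const rfl) (by rintro _ rfl; exact h) (by omega)

theorem Runs.addSeq {x y z : ℕ} (h : Runs q (σ.setReg x (σ.reg y + σ.reg z)) T R) :
    Runs (.seq (.add x y z) q) σ (T + 1) R :=
  Runs.seq (Q := fun τ => τ = σ.setReg x (σ.reg y + σ.reg z)) (.add rfl)
    (by rintro _ rfl; exact h) (by omega)

theorem Runs.branch {x y : ℕ} (hp : σ.reg x < σ.reg y → Runs p σ S Q)
    (hq : ¬ σ.reg x < σ.reg y → Runs q σ T Q) (hU : S + T + 1 ≤ U) :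
    Runs (.branch x y p q) σ U Q := by
  by_cases h : σ.reg x < σ.reg y
  · obtain ⟨t, τ, he, ht, hτ⟩ := hp h
    exact ⟨_, τ, .branch_true h he, by omega, hτ⟩
  · obtain ⟨t, τ, he, ht, hτ⟩ := hq h
    exact ⟨_, τ, .branch_false h he, by omega, hτ⟩

/-- A loop whose counter `x` runs up to the content `n` of `y`. -/
theorem Runs.loop {x y n : ℕ} (I : ℕ → State → Prop)
    (hI : ∀ i τ, I i τ → τ.reg x = i ∧ τ.reg y = n) (h0 : I 0 σ)
    (hp : ∀ i τ, i < n → I i τ → Runs p τ S (I (i + 1))) :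
    Runs (.loop x y p) σ (n * (S + 1) + 1) (I n) := by
  have key : ∀ j i τ, i + j = n → I i τ → Runs (.loop x y p) τ (j * (S + 1) + 1) (I n) := by
    intro j
    induction j with
    | zero =>
      intro i τ hij h
      obtain rfl : i = n := by omega
      obtain ⟨hx, hy⟩ := hI i τ h
      exact ⟨1, τ, .loop_false (by omega), by omega, h⟩
    | succ j ih =>
      intro i τ hij h
      obtain ⟨hx, hy⟩ := hI i τ h
      obtain ⟨s, υ, he, hs, hυ⟩ := hp i τ (by omega) h
      obtain ⟨t, φ, he', ht, hφ⟩ := ih (i + 1) υ (by omega) hυ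
      refine ⟨s + t + 1, φ, .loop_true (by omega) he he', ?_, hφ⟩
      rw [Nat.succ_mul]
      omega
  exact key n 0 σ (by omega) h0

end Rules

@[simp] theorem State.setReg_mem (σ : State) (x v : ℕ) : (σ.setReg x v).mem = σ.mem := rfl
@[simp] theorem State.setMem_reg (σ : State) (a v : ℕ) : (σ.setMem a v).reg = σ.reg := rfl

theorem State.setReg_reg (σ : State) (x v y : ℕ) :
    (σ.setReg x v).reg y = if y = x then v else σ.reg y := by
  simp [State.setReg, Function.update_apply]

theorem State.setMem_mem (σ : State) (a v c : ℕ) :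
    (σ.setMem a v).mem c = if c = a then v else σ.mem c := by
  simp [State.setMem, Function.update_apply]

theorem State.view_eq_iff {σ τ : State} :
    σ.view = τ ↔ (∀ x, σ.reg (3 * x) = τ.reg x) ∧ σ.mem = τ.mem := by
  cases τ
  simp [State.view, funext_iff]

theorem Expr.runs_compile (n : ℕ) (a : Expr) : ∀ (t : ℕ) (σ : State), σ.reg 1 = n →
    Runs (a.compile t) σ (a.cost.eval n) (fun τ => τ.reg (3 * t + 2) = a.eval n σ.view ∧
      τ.mem = σ.mem ∧ ∀ r, (∀ s, t ≤ s → r ≠ 3 * s + 2) → τ.reg r = σ.reg r) := by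
  induction a with
  | const k =>
    intro t σ hn
    refine (Runs.const ?_).mono (by simp [cost]) fun _ h => h
    refine ⟨by simp [State.setReg_reg, eval], rfl, fun r hr => ?_⟩
    simp [State.setReg_reg, hr t le_rfl]
  | size =>
    intro t σ hn
    refine (Runs.constSeq (Runs.add ?_)).mono (by simp [cost]) fun _ h => h
    refine ⟨by simp [State.setReg_reg, eval, hn], rfl, fun r hr => ?_⟩
    simp [State.setReg_reg, hr t le_rfl]
  | var x =>
    intro t σ hn
    refine (Runs.constSeq (Runs.add ?_)).mono (by simp [cost]) fun _ h => h
    refine ⟨?_, rfl, fun r hr => ?_⟩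
    · have : 3 * x ≠ 3 * t + 2 := by omega
      simp [State.setReg_reg, eval, State.view, this]
    · simp [State.setReg_reg, hr t le_rfl]
  | add a b iha ihb =>
    intro t σ hn
    refine (iha t σ hn).seq (fun τ ⟨h1, h2, h3⟩ => (ihb (t + 1) τ ?_).seq
      (fun υ ⟨h4, h5, h6⟩ => Runs.add (Q := _) ?_) le_rfl) (by simp [cost, add_assoc])
    · rw [h3 1 (by omega), hn]
    · have e : τ.view = σ.view := by
        rw [State.view_eq_iff]
        exact ⟨fun x => h3 _ (by omega), h2⟩
      refine ⟨?_, by simp [h5, h2], fun r hr => ?_⟩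
      · simp [State.setReg_reg, eval, h4, e, ← h1, h6 (3 * t + 2) (by omega)]
      · simp only [State.setReg_reg, hr t le_rfl, if_false]
        rw [h6 r fun s hs => hr s (by omega), h3 r hr]
  | mem a iha =>
    intro t σ hn
    refine (iha t σ hn).seq (fun τ ⟨h1, h2, h3⟩ => Runs.load (Q := _) ?_) (by simp [cost])
    refine ⟨by simp [State.setReg_reg, eval, h1, h2, State.view], by simp [h2], fun r hr => ?_⟩
    simp [State.setReg_reg, hr t le_rfl, h3 r hr]
  | ite a b c d iha ihb ihc ihd =>
    intro t σ hn
    refine (iha t σ hn).seq (fun τ ⟨h1, h2, h3⟩ => (ihb (t + 1) τ ?_).seq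
      (T := c.cost.eval n + d.cost.eval n + 1)
      (fun υ ⟨h4, h5, h6⟩ => Runs.branch ?_ ?_ le_rfl) le_rfl) (by simp [cost, add_assoc])
    · rw [h3 1 (by omega), hn]
    all_goals
      have e : τ.view = σ.view := by
        rw [State.view_eq_iff]
        exact ⟨fun x => h3 _ (by omega), h2⟩
      have e' : υ.view = σ.view := by
        rw [State.view_eq_iff]
        exact ⟨fun x => by rw [h6 _ (by omega), h3 _ (by omega)]; rfl, h5.trans h2⟩
      have hn' : υ.reg 1 = n := by rw [h6 1 (by omega), h3 1 (by omega), hn]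
      rw [h4, h6 (3 * t + 2) (by omega), h1, e]
      intro hlt
    · refine (ihc t υ hn').mono le_rfl fun φ ⟨h7, h8, h9⟩ => ⟨?_, ?_, fun r hr => ?_⟩
      · rw [h7, e', eval, if_pos hlt]
      · rw [h8, h5, h2]
      · rw [h9 r hr, h6 r fun s hs => hr s (by omega), h3 r hr]
    · refine (ihd t υ hn').mono le_rfl fun φ ⟨h7, h8, h9⟩ => ⟨?_, ?_, fun r hr => ?_⟩
      · rw [h7, e', eval, if_neg hlt]
      · rw [h8, h5, h2]
      · rw [h9 r hr, h6 r fun s hs => hr s (by omega), h3 r hr]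
  | sum x a iha =>
    intro t σ hn
    have body : ∀ (i : ℕ) (τ : State), τ.reg 1 = n →
        Runs (.seq (a.compile (t + 2))
        (.seq (.add (3 * t + 2) (3 * t + 2) (3 * (t + 2) + 2))
        (.seq (.const (3 * (t + 2) + 2) 1)
          (.add (3 * x) (3 * x) (3 * (t + 2) + 2))))) τ (a.cost.eval n + 3)
        (fun υ => υ.reg (3 * t + 2) = τ.reg (3 * t + 2) + a.eval n τ.view ∧
          υ.reg (3 * x) = τ.reg (3 * x) + 1 ∧ υ.mem = τ.mem ∧
          ∀ r, r ≠ 3 * x → (∀ s, t + 2 ≤ s ∨ s = t → r ≠ 3 * s + 2) → υ.reg r = τ.reg r) := by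
      intro i τ hτ
      refine (iha (t + 2) τ hτ).seq (fun υ ⟨h1, h2, h3⟩ => Runs.addSeq (Runs.constSeq
        (Runs.add (Q := _) ?_))) le_rfl
      have e1 : 3 * t + 2 ≠ 3 * x := by omega
      have e2 : 3 * t + 2 ≠ 3 * (t + 2) + 2 := by omega
      have e3 : 3 * x ≠ 3 * (t + 2) + 2 := by omega
      refine ⟨?_, ?_, by simp [h2], fun r hx hr => ?_⟩
      · simp only [State.setReg_reg, e1, e2, if_false, if_true, h1]
        rw [h3 _ (by omega)]
      · simp only [State.setReg_reg, e1.symm, e3, if_false, if_true]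
        rw [h3 _ (by omega)]
      · simp only [State.setReg_reg, hx, hr t (by simp), hr (t + 2) (by simp), if_false]
        exact h3 r fun s hs => hr s (.inl hs)
    let σ' := (((σ.setReg (3 * (t + 2) + 2) 0).setReg (3 * (t + 1) + 2) (σ.reg (3 * x))).setReg
      (3 * t + 2) 0).setReg (3 * x) 0
    have e1 : 3 * x ≠ 3 * t + 2 := by omega
    have e2 : 3 * x ≠ 3 * (t + 1) + 2 := by omega
    have e3 : 3 * x ≠ 3 * (t + 2) + 2 := by omega
    have e4 : 3 * (t + 1) + 2 ≠ 3 * t + 2 := by omega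
    have e5 : 3 * (t + 2) + 2 ≠ 3 * t + 2 := by omega
    have e6 : 3 * (t + 2) + 2 ≠ 3 * (t + 1) + 2 := by omega
    have hloop := Runs.loop (n := n) (σ := σ') (x := 3 * x) (y := 1) (fun i τ => τ.reg (3 * x) = i ∧
        τ.reg 1 = n ∧ τ.mem = σ.mem ∧ τ.reg (3 * (t + 1) + 2) = σ.reg (3 * x) ∧
        τ.reg (3 * t + 2) = ∑ j ∈ Finset.range i, a.eval n (σ.view.setReg x j) ∧
        ∀ r, r ≠ 3 * x → (∀ s, t ≤ s → r ≠ 3 * s + 2) → τ.reg r = σ.reg r)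
      (fun i τ h => ⟨h.1, h.2.1⟩)
      (by
        refine ⟨by simp [σ', State.setReg_reg], ?_, rfl, ?_, ?_, fun r hx hr => ?_⟩
        · have h1 : 1 ≠ 3 * x := by omega
          have h2 : 1 ≠ 3 * (t + 2) + 2 := by omega
          have h3 : 1 ≠ 3 * (t + 1) + 2 := by omega
          have h4 : 1 ≠ 3 * t + 2 := by omega
          simp only [σ', State.setReg_reg, h1, h2, h3, h4, if_false, hn]
        · simp only [σ', State.setReg_reg, e2.symm, e4, if_false, if_true]
        · simp [σ', State.setReg_reg, e1.symm]
        · simp only [σ', State.setReg_reg, hx, hr t (by simp), hr (t + 1) (by simp),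
            hr (t + 2) (by simp), if_false])
      (by
        rintro i τ hi ⟨h1, h2, h3, h4, h5, h6⟩
        refine (body i τ h2).mono le_rfl fun υ ⟨k1, k2, k3, k4⟩ =>
          ⟨by rw [k2, h1], ?_, k3.trans h3, ?_, ?_, fun r hx hr => ?_⟩
        · rw [k4 1 (by omega) (by omega), h2]
        · rw [k4 _ (by omega) (by omega), h4]
        · rw [k1, h5, Finset.sum_range_succ]
          congr 2
          rw [State.view_eq_iff]
          refine ⟨fun y => ?_, h3⟩
          rw [State.setReg_reg]
          split_ifs with hy
          · rw [hy, h1]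
          · exact h6 _ (by omega) (by omega)
        · rw [k4 r hx fun s hs => hr s (by omega), h6 r hx hr])
    refine (Runs.constSeq (Runs.addSeq (Runs.constSeq (Runs.constSeq
      (hloop.seq (R := fun τ => τ.reg (3 * t + 2) = (sum x a).eval n σ.view ∧
      τ.mem = σ.mem ∧ ∀ r, (∀ s, t ≤ s → r ≠ 3 * s + 2) → τ.reg r = σ.reg r) (fun τ h => ?_)
        (le_refl (_ + 2))) |> fun h => by
        simpa only [σ', State.setReg_reg, e3, if_false, if_true, add_zero] using h)))).mono
      (by simp [cost]; ring_nf; omega) fun _ h => h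
    obtain ⟨h1, h2, h3, h4, h5, h6⟩ := h
    refine Runs.constSeq (Runs.add (Q := _) ⟨?_, by simp [h3], fun r hr => ?_⟩)
    · simp only [State.setReg_reg, e1.symm, e5.symm, if_false, h5, eval]
    · by_cases hx : r = 3 * x
      · simp [hx, State.setReg_reg, h4]
      · simp only [State.setReg_reg, hx, hr (t + 2) (by simp), if_false]
        exact h6 r hx hr

theorem Stmt.runs_compile (n : ℕ) (s : Stmt) : ∀ (d : ℕ) (σ : State), σ.reg 1 = n →
    Runs (s.compile d) σ (s.cost.eval n) (fun τ => τ.view = s.run n σ.view ∧ τ.reg 1 = n ∧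
      ∀ e, e < d → τ.reg (3 * e + 4) = σ.reg (3 * e + 4)) := by
  induction s with
  | skip =>
    intro d σ hn
    exact ⟨1, σ, .skip σ, by simp [cost], rfl, hn, fun _ _ => rfl⟩
  | assign x a =>
    intro d σ hn
    refine (a.runs_compile n 0 σ hn).seq (fun τ ⟨h1, h2, h3⟩ => Runs.constSeq
      (Runs.add (Q := _) ⟨?_, ?_, fun e he => ?_⟩)) (by simp [cost])
    · rw [State.view_eq_iff]
      refine ⟨fun y => ?_, by simp [run, h2, State.view]⟩
      simp only [State.setReg_reg, run, mul_eq_mul_left_iff]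
      by_cases hy : y = x
      · simpa [hy] using h1
      · have : 3 * y ≠ 5 := by omega
        simp [hy, this, State.view, h3 (3 * y) (by omega)]
    · have : 1 ≠ 3 * x := by omega
      simp [State.setReg_reg, this, h3 1 (by omega), hn]
    · have h4 : 3 * e + 4 ≠ 3 * x := by omega
      have h5 : 3 * e + 4 ≠ 5 := by omega
      simp [State.setReg_reg, h4, h5, h3 (3 * e + 4) (by omega)]
  | store a b =>
    intro d σ hn
    refine (a.runs_compile n 0 σ hn).seq (fun τ ⟨h1, h2, h3⟩ => (b.runs_compile n 1 τ ?_).seq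
      (fun υ ⟨h4, h5, h6⟩ => Runs.store (Q := _) ⟨?_, ?_, fun e he => ?_⟩) le_rfl)
      (by simp [cost, add_assoc])
    · rw [h3 1 (by omega), hn]
    · have e : τ.view = σ.view := by
        rw [State.view_eq_iff]
        exact ⟨fun x => h3 _ (by omega), h2⟩
      rw [State.view_eq_iff]
      refine ⟨fun y => ?_, ?_⟩
      · simp only [State.setMem_reg, run]
        rw [h6 _ (by omega), h3 _ (by omega)]
        rfl
      · simp only [run]
        rw [show υ.reg 5 = _ from h4, h6 2 (by omega), show τ.reg 2 = _ from h1, e]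
        simp [State.setMem, h5, h2, State.view]
    · simp [h6 1 (by omega), h3 1 (by omega), hn]
    · simp [h6 (3 * e + 4) (by omega), h3 (3 * e + 4) (by omega)]
  | seq s t ihs iht =>
    intro d σ hn
    refine (ihs d σ hn).seq (fun τ ⟨h1, h2, h3⟩ => (iht d τ h2).mono le_rfl
      fun υ ⟨h4, h5, h6⟩ => ⟨by rw [h4, h1, run], h5, fun e he => by rw [h6 e he, h3 e he]⟩)
      (by simp [cost])
  | ite a b s t ihs iht =>
    intro d σ hn
    refine (a.runs_compile n 0 σ hn).seq (fun τ ⟨h1, h2, h3⟩ => (b.runs_compile n 1 τ ?_).seq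
      (T := s.cost.eval n + t.cost.eval n + 1)
      (fun υ ⟨h4, h5, h6⟩ => Runs.branch ?_ ?_ le_rfl) le_rfl) (by simp [cost, add_assoc])
    · rw [h3 1 (by omega), hn]
    all_goals
      have e : τ.view = σ.view := by
        rw [State.view_eq_iff]
        exact ⟨fun x => h3 _ (by omega), h2⟩
      have e' : υ.view = σ.view := by
        rw [State.view_eq_iff]
        exact ⟨fun x => by rw [h6 _ (by omega), h3 _ (by omega)]; rfl, h5.trans h2⟩
      have hn' : υ.reg 1 = n := by rw [h6 1 (by omega), h3 1 (by omega), hn]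
      have hc : ∀ e, υ.reg (3 * e + 4) = σ.reg (3 * e + 4) := fun e => by
        rw [h6 _ (by omega), h3 _ (by omega)]
      rw [show υ.reg 5 = _ from h4, h6 2 (by omega), show τ.reg 2 = _ from h1, e]
      intro hlt
    · exact (ihs d υ hn').mono le_rfl fun φ ⟨h7, h8, h9⟩ =>
        ⟨by rw [h7, e', run, if_pos hlt], h8, fun e he => by rw [h9 e he, hc]⟩
    · exact (iht d υ hn').mono le_rfl fun φ ⟨h7, h8, h9⟩ =>
        ⟨by rw [h7, e', run, if_neg hlt], h8, fun e he => by rw [h9 e he, hc]⟩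
  | loop x s ihs =>
    intro d σ hn
    have hloop := Runs.loop (n := n) (σ := σ.setReg (3 * d + 4) 0) (x := 3 * d + 4) (y := 1)
      (S := s.cost.eval n + 4)
      (p := .seq (.const 2 0) (.seq (.add (3 * x) (3 * d + 4) 2)
        (.seq (s.compile (d + 1)) (.seq (.const 2 1) (.add (3 * d + 4) (3 * d + 4) 2)))))
      (fun i τ => τ.reg (3 * d + 4) = i ∧ τ.reg 1 = n ∧
        τ.view = Nat.rec σ.view (fun i τ => s.run n (τ.setReg x i)) i ∧
        ∀ e, e < d → τ.reg (3 * e + 4) = σ.reg (3 * e + 4))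
      (fun i τ h => ⟨h.1, h.2.1⟩)
      (by
        refine ⟨by simp [State.setReg_reg], by simp [State.setReg_reg, hn], ?_, fun e he => ?_⟩
        · rw [State.view_eq_iff]
          refine ⟨fun y => ?_, rfl⟩
          have : 3 * y ≠ 3 * d + 4 := by omega
          simp [State.setReg_reg, this, State.view]
        · have : e ≠ d := by omega
          simp [State.setReg_reg, this])
      (by
        rintro i τ hi ⟨h1, h2, h3, h4⟩
        have e1 : 3 * d + 4 ≠ 2 := by omega
        have e2 : 1 ≠ 3 * x := by omega
        have e3 : 3 * d + 4 ≠ 3 * x := by omega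
        refine (Runs.constSeq (Runs.addSeq ((ihs (d + 1) _ ?_).seq (fun υ ⟨k1, k2, k3⟩ =>
          Runs.constSeq (Runs.add (Q := _) ⟨?_, ?_, ?_, fun e he => ?_⟩)) le_rfl))).mono
          (by omega) fun _ h => h
        · simp [State.setReg_reg, e2, h2]
        · simp [State.setReg_reg, e1, e3, k3 d (by omega), h1]
        · simp [State.setReg_reg, k2]
        · simp only []
          rw [← h3]
          have e : (((τ.setReg 2 0).setReg (3 * x) ((τ.setReg 2 0).reg (3 * d + 4) +
              (τ.setReg 2 0).reg 2))).view = τ.view.setReg x i := by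
            rw [State.view_eq_iff]
            refine ⟨fun y => ?_, rfl⟩
            have : 3 * y ≠ 2 := by omega
            simp [State.setReg_reg, e1, h1, this, State.view]
          rw [← e, ← k1, State.view_eq_iff]
          refine ⟨fun y => ?_, rfl⟩
          have e4 : 3 * y ≠ 2 := by omega
          have e5 : 3 * y ≠ 3 * d + 4 := by omega
          simp [State.setReg_reg, e4, e5, State.view]
        · have e4 : 3 * e + 4 ≠ 3 * x := by omega
          have e5 : e ≠ d := by omega
          simp [State.setReg_reg, e4, e5, k3 e (by omega), h4 e he])
    refine (Runs.constSeq (hloop.seq (T := 1) (R := fun τ => τ.view = (loop x s).run n σ.view ∧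
      τ.reg 1 = n ∧ ∀ e, e < d → τ.reg (3 * e + 4) = σ.reg (3 * e + 4))
      (fun τ ⟨h1, h2, h3, h4⟩ => Runs.const ⟨?_, ?_, fun e he => ?_⟩) le_rfl)).mono
      (by simp [cost]; ring_nf; omega) fun _ h => h
    · simp only [run]
      rw [← h3, State.view_eq_iff]
      refine ⟨fun y => ?_, rfl⟩
      simp [State.setReg_reg, State.view]
    · have : 1 ≠ 3 * x := by omega
      simp [State.setReg_reg, this, h2]
    · have : 3 * e + 4 ≠ 3 * x := by omega
      simp [State.setReg_reg, this, h4 e he]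

/-- Every statement is realized by a program in polynomial time, on input words that begin with
the bound `n` of the loops. -/
theorem Stmt.exists_prog (s : Stmt) : ∃ (P : Prog) (q : ℕ[X]), ∀ (n : ℕ) (w : List ℕ),
    ∃ t σ, Exec P (State.init (n :: w)) t σ ∧ t ≤ q.eval n ∧
      σ.mem = (s.run n (State.init (n :: w))).mem := by
  refine ⟨.seq (.load 1 0) (s.compile 0), 1 + s.cost, fun n w => ?_⟩
  obtain ⟨t, σ, h, ht, h1, -, -⟩ := s.runs_compile n 0 ((State.init (n :: w)).setReg 1 n)
    (by simp [State.setReg_reg])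
  refine ⟨_, σ, .seq (.load _ _ _) h, by simpa using ht, ?_⟩
  have e : ((State.init (n :: w)).setReg 1 n).view = State.init (n :: w) := by
    rw [State.view_eq_iff]
    refine ⟨fun y => ?_, rfl⟩
    have : 3 * y ≠ 1 := by omega
    simp [State.setReg_reg, this, State.init]
  rw [← e, ← h1]
  rfl

end RAM

/-! ### Rotations seen from the girls' side -/

namespace StableMatching

open SMInstance Function

variable {n : ℕ} {A : SMInstance n} {M N T K : Matching n} {ρ ρ' : List (Fin n × Fin n)}

namespace SMInstance

/-- The position of girl `g` on the list of boy `b`. -/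
def boyRank (A : SMInstance n) (b g : Fin n) : Fin n := (A.boyList b).symm g

/-- The position of boy `b` on the list of girl `g`. -/
def girlRank (A : SMInstance n) (g b : Fin n) : Fin n := (A.girlList g).symm b

theorem boyRank_inj {b g g' : Fin n} : A.boyRank b g = A.boyRank b g' ↔ g = g' :=
  (A.boyList b).symm.injective.eq_iff

theorem girlRank_inj {g b b' : Fin n} : A.girlRank g b = A.girlRank g b' ↔ b = b' :=
  (A.girlList g).symm.injective.eq_iff

/-- No boy is better off in `T` than in `N`. -/
def Dominates (A : SMInstance n) (N T : Matching n) : Prop :=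
  ∀ b, A.boyRank b (N b) ≤ A.boyRank b (T b)

/-- `b` is the first boy on the list of `g` who strictly prefers `g` to his partner in `T`. -/
def IsDualFirst (A : SMInstance n) (T : Matching n) (g b : Fin n) : Prop :=
  A.boyRank b g < A.boyRank b (T b) ∧
    ∀ c, A.girlRank g c < A.girlRank g b → ¬ A.boyRank c g < A.boyRank c (T c)

/-- The list is a cycle of the map that sends a girl to the `T`-partner of the first boy on her
list who strictly prefers her to his `T`-partner; the boys on the way are recorded. -/
def IsDualCycle (A : SMInstance n) (T : Matching n) (ρ : List (Fin n × Fin n)) : Prop :=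
  ρ ≠ [] ∧ ρ.Nodup ∧ ∀ (i : ℕ) (h : i < ρ.length), A.IsDualFirst T ρ[i].2 ρ[i].1 ∧
    T ρ[i].1 = (ρ[(i + 1) % ρ.length]'(Nat.mod_lt _ (Nat.zero_lt_of_lt h))).2

end SMInstance

theorem girlRank_lt_of_boyRank_lt (hM : M ∈ A.stableMatchings) {b g : Fin n}
    (h : A.boyRank b g < A.boyRank b (M b)) : A.girlRank g (M.symm g) < A.girlRank g b := by
  have h1 : ¬ A.girlRank g b < A.girlRank g (M.symm g) := fun h' => hM b g ⟨h, h'⟩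
  refine lt_of_le_of_ne (not_lt.1 h1) fun h2 => ?_
  rw [girlRank_inj] at h2
  rw [← h2, M.apply_symm_apply] at h
  exact lt_irrefl _ h

theorem boyRank_lt_of_girlRank_lt (hM : M ∈ A.stableMatchings) {b g : Fin n}
    (h : A.girlRank g b < A.girlRank g (M.symm g)) : A.boyRank b (M b) < A.boyRank b g := by
  have h1 : ¬ A.boyRank b g < A.boyRank b (M b) := fun h' => hM b g ⟨h', h⟩
  refine lt_of_le_of_ne (not_lt.1 h1) fun h2 => ?_
  rw [boyRank_inj] at h2
  rw [← h2, M.symm_apply_apply] at h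
  exact lt_irrefl _ h

theorem SMInstance.Dominates.antisymm (h : A.Dominates N T) (h' : A.Dominates T N) : N = T :=
  Equiv.ext fun b => boyRank_inj.1 (le_antisymm (h b) (h' b))

/-- In the worse of two comparable matchings for the boys, the girls are better off. -/
theorem SMInstance.Dominates.girlRank_le (h : A.Dominates N T) (hT : T ∈ A.stableMatchings)
    (g : Fin n) : A.girlRank g (T.symm g) ≤ A.girlRank g (N.symm g) := by
  by_contra! hlt
  have h1 := boyRank_lt_of_girlRank_lt hT hlt
  have h2 := h (N.symm g)
  rw [N.apply_symm_apply] at h2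
  exact absurd h1 (not_lt.2 h2)

/-- Any two stable matchings have an upper bound in which every boy has one of his two partners. -/
theorem exists_join (hM : M ∈ A.stableMatchings) (hN : N ∈ A.stableMatchings) :
    ∃ K ∈ A.stableMatchings, A.Dominates K M ∧ A.Dominates K N ∧
      ∀ b, K b = M b ∨ K b = N b := by
  let f : Fin n → Fin n := fun b => if A.boyRank b (M b) ≤ A.boyRank b (N b) then M b else N b
  have hf : ∀ b, f b = M b ∨ f b = N b := fun b => by
    simp only [f]
    split_ifs <;> simp
  have hfM : ∀ b, A.boyRank b (f b) ≤ A.boyRank b (M b) := fun b => by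
    simp only [f]
    split_ifs with h
    · exact le_rfl
    · exact (not_le.1 h).le
  have hfN : ∀ b, A.boyRank b (f b) ≤ A.boyRank b (N b) := fun b => by
    simp only [f]
    split_ifs with h
    · exact h
    · exact le_rfl
  have key : ∀ b c, M b = N c → f b = M b → f c = N c → b = c := by
    intro b c h hb hc
    by_contra hne
    have h1 : A.boyRank b (M b) < A.boyRank b (N b) :=
      lt_of_le_of_ne (hb ▸ hfN b) fun e => hne (N.injective ((boyRank_inj.1 e).symm.trans h))
    have h2 : A.boyRank c (N c) < A.boyRank c (M c) :=
      lt_of_le_of_ne (hc ▸ hfM c) fun e => hne (M.injective (h.trans (boyRank_inj.1 e)))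
    have h3 := girlRank_lt_of_boyRank_lt hN h1
    have h4 := girlRank_lt_of_boyRank_lt hM h2
    rw [← h, M.symm_apply_apply] at h4
    rw [h, N.symm_apply_apply] at h3
    rw [h] at h4
    exact lt_asymm h3 h4
  have hinj : Injective f := by
    intro b c h
    rcases hf b with hb | hb <;> rcases hf c with hc | hc
    · exact M.injective (by rw [← hb, ← hc, h])
    · exact key b c (by rw [← hb, ← hc, h]) hb hc
    · exact (key c b (by rw [← hb, ← hc, h]) hc hb).symm
    · exact N.injective (by rw [← hb, ← hc, h])
  refine ⟨Equiv.ofBijective f (Finite.injective_iff_bijective.1 hinj), ?_, hfM, hfN, hf⟩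
  set K := Equiv.ofBijective f (Finite.injective_iff_bijective.1 hinj)
  rintro b g ⟨h1, h2⟩
  have h1 : A.boyRank b g < A.boyRank b (f b) := h1
  rcases hf (K.symm g) with h | h <;> rw [show f (K.symm g) = g from K.apply_symm_apply g] at h
  · refine hM b g ⟨h1.trans_le (hfM b), ?_⟩
    rwa [show M.symm g = K.symm g by rw [Equiv.symm_apply_eq]; exact h]
  · refine hN b g ⟨h1.trans_le (hfN b), ?_⟩
    rwa [show N.symm g = K.symm g by rw [Equiv.symm_apply_eq]; exact h]

theorem SMInstance.IsDualFirst.unique {g b c : Fin n} (hb : A.IsDualFirst T g b)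
    (hc : A.IsDualFirst T g c) : b = c := by
  rw [← A.girlRank_inj (g := g)]
  exact le_antisymm (not_lt.1 fun h => hb.2 c h hc.1) (not_lt.1 fun h => hc.2 b h hb.1)

/-! ### Exposed rotations and dual cycles -/

section Exposed

variable (h : A.IsExposed M ρ)
include h

theorem SMInstance.IsExposed.nodup_boys : (ρ.map Prod.fst).Nodup := by
  refine h.2.2.1.map_on fun p hp q hq e => Prod.ext e ?_
  rw [← h.2.2.2.1 p hp, ← h.2.2.2.1 q hq, e]

theorem SMInstance.IsExposed.isFirstWilling (i : ℕ) (hi : i < ρ.length) :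
    A.IsFirstWilling M ρ[i].1 (ρ[(i + 1) % ρ.length]'(Nat.mod_lt _ (Nat.zero_lt_of_lt hi))).2 := by
  obtain ⟨g, h1, h2⟩ := h.2.2.2.2 i hi
  rw [Equiv.symm_apply_eq, h.2.2.2.1 _ (List.getElem_mem _)] at h2
  rwa [← h2]

theorem SMInstance.IsExposed.eliminate_getElem (i : ℕ) (hi : i < ρ.length) :
    eliminate M ρ ρ[i].1 = (ρ[(i + 1) % ρ.length]'(Nat.mod_lt _ (Nat.zero_lt_of_lt hi))).2 := by
  have := List.formPerm_apply_getElem _ h.nodup_boys i (by simpa using hi)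
  simp only [List.getElem_map, List.length_map] at this
  rw [eliminate, Equiv.trans_apply, this, h.2.2.2.1 _ (List.getElem_mem _)]

omit h in
theorem eliminate_of_notMem {b : Fin n} (hb : b ∉ ρ.map Prod.fst) : eliminate M ρ b = M b := by
  rw [eliminate, Equiv.trans_apply, List.formPerm_apply_of_notMem hb]

theorem SMInstance.IsExposed.isFirstWilling_of_ne {b : Fin n} (hb : eliminate M ρ b ≠ M b) :
    A.IsFirstWilling M b (eliminate M ρ b) := by
  have hm : b ∈ ρ.map Prod.fst := by
    by_contra hm
    exact hb (eliminate_of_notMem hm)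
  obtain ⟨p, hp, rfl⟩ := List.mem_map.1 hm
  obtain ⟨i, hi, rfl⟩ := List.getElem_of_mem hp
  rw [h.eliminate_getElem i hi]
  exact h.isFirstWilling i hi

theorem SMInstance.IsExposed.dominates : A.Dominates M (eliminate M ρ) := by
  intro b
  by_cases hb : eliminate M ρ b = M b
  · rw [hb]
  · exact (boyRank_lt_of_girlRank_lt h.1 (h.isFirstWilling_of_ne hb).1).le

theorem SMInstance.IsExposed.eliminate_mem : eliminate M ρ ∈ A.stableMatchings := by
  set T := eliminate M ρ with hT
  rintro c g ⟨h1, h2⟩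
  have h1 : A.boyRank c g < A.boyRank c (T c) := h1
  have h2 : A.girlRank g c < A.girlRank g (T.symm g) := h2
  have h3 : A.girlRank g (T.symm g) ≤ A.girlRank g (M.symm g) := by
    by_cases hd : T (T.symm g) = M (T.symm g)
    · rw [T.apply_symm_apply, ← Equiv.symm_apply_eq] at hd
      rw [hd]
    · have := (h.isFirstWilling_of_ne hd).1
      rw [← hT, T.apply_symm_apply] at this
      exact le_of_lt this
  have h4 := boyRank_lt_of_girlRank_lt h.1 (h2.trans_le h3)
  have h5 : T c ≠ M c := fun e => by
    rw [e] at h1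
    exact lt_asymm h1 h4
  exact (h.isFirstWilling_of_ne h5).2 g h1 (h2.trans_le h3)

/-- A rotation that is exposed in `M` is a dual cycle of the matching that results from its
elimination. -/
theorem SMInstance.IsExposed.isDualCycle : A.IsDualCycle (eliminate M ρ) ρ := by
  refine ⟨h.2.1, h.2.2.1, fun i hi => ⟨⟨?_, fun c h1 h2 => ?_⟩, h.eliminate_getElem i hi⟩⟩
  · have h1 := boyRank_lt_of_girlRank_lt h.1 (h.isFirstWilling i hi).1
    rwa [h.2.2.2.1 _ (List.getElem_mem _), ← h.eliminate_getElem i hi] at h1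
  · have h3 : M.symm ρ[i].2 = ρ[i].1 := by
      rw [Equiv.symm_apply_eq, h.2.2.2.1 _ (List.getElem_mem _)]
    rw [← h3] at h1
    have h4 := boyRank_lt_of_girlRank_lt h.1 h1
    have h5 : eliminate M ρ c ≠ M c := fun e => by
      rw [e] at h2
      exact lt_asymm h2 h4
    exact (h.isFirstWilling_of_ne h5).2 _ h2 h1

end Exposed

section Cycle

variable (h : A.IsDualCycle T ρ)
include h

theorem SMInstance.IsDualCycle.eq_of_snd_eq {p q : Fin n × Fin n} (hp : p ∈ ρ) (hq : q ∈ ρ)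
    (e : p.2 = q.2) : p = q := by
  obtain ⟨i, hi, rfl⟩ := List.getElem_of_mem hp
  obtain ⟨j, hj, rfl⟩ := List.getElem_of_mem hq
  have h1 := (h.2.2 i hi).1
  rw [e] at h1
  exact Prod.ext (h1.unique (h.2.2 j hj).1) e

theorem SMInstance.IsDualCycle.nodup_boys : (ρ.map Prod.fst).Nodup := by
  refine h.2.1.map_on fun p hp q hq e => ?_
  obtain ⟨i, hi, rfl⟩ := List.getElem_of_mem hp
  obtain ⟨j, hj, rfl⟩ := List.getElem_of_mem hq
  have h1 := (h.2.2 i hi).2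
  rw [e, (h.2.2 j hj).2] at h1
  have h2 := h.eq_of_snd_eq (List.getElem_mem _) (List.getElem_mem _) h1
  rw [h.2.1.getElem_inj_iff] at h2
  have h3 : j ≡ i [MOD ρ.length] := Nat.ModEq.add_right_cancel' 1 h2
  obtain rfl := h3.eq_of_lt_of_lt hj hi
  rfl

/-- The matching from which `T` results by elimination of the cycle. -/
def restore {n : ℕ} (T : Matching n) (ρ : List (Fin n × Fin n)) : Matching n :=
  (ρ.map Prod.fst).formPerm.symm.trans T

omit h in
theorem eliminate_restore : eliminate (restore T ρ) ρ = T := by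
  ext b
  simp [eliminate, restore]

omit h in
theorem restore_of_notMem {b : Fin n} (hb : b ∉ ρ.map Prod.fst) : restore T ρ b = T b := by
  rw [restore, Equiv.trans_apply, (Equiv.symm_apply_eq _).2]
  rw [List.formPerm_apply_of_notMem hb]

theorem SMInstance.IsDualCycle.restore_apply {p : Fin n × Fin n} (hp : p ∈ ρ) :
    restore T ρ p.1 = p.2 := by
  obtain ⟨i, hi, rfl⟩ := List.getElem_of_mem hp
  have hpos : 0 < ρ.length := Nat.zero_lt_of_lt hi
  have hj : (i + ρ.length - 1) % ρ.length < ρ.length := Nat.mod_lt _ hpos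
  have e : ((i + ρ.length - 1) % ρ.length + 1) % ρ.length = i := by
    rw [Nat.mod_add_mod, show i + ρ.length - 1 + 1 = i + ρ.length by omega, Nat.add_mod_right,
      Nat.mod_eq_of_lt hi]
  have h1 := List.formPerm_apply_getElem _ h.nodup_boys _ (by simpa using hj)
  simp only [List.getElem_map, List.length_map, e] at h1
  have h2 := (h.2.2 _ hj).2
  simp only [e] at h2
  rw [restore, Equiv.trans_apply, ← h1, Equiv.symm_apply_apply, h2]

theorem SMInstance.IsDualCycle.mem_of_restore_ne {b : Fin n} (hb : restore T ρ b ≠ T b) :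
    (b, restore T ρ b) ∈ ρ := by
  have hm : b ∈ ρ.map Prod.fst := by
    by_contra hm
    exact hb (restore_of_notMem hm)
  obtain ⟨p, hp, rfl⟩ := List.mem_map.1 hm
  rwa [h.restore_apply hp]

theorem SMInstance.IsDualCycle.isDualFirst {p : Fin n × Fin n} (hp : p ∈ ρ) :
    A.IsDualFirst T p.2 p.1 := by
  obtain ⟨i, hi, rfl⟩ := List.getElem_of_mem hp
  exact (h.2.2 i hi).1

theorem SMInstance.IsDualCycle.dominates_restore : A.Dominates (restore T ρ) T := by
  intro b
  by_cases hb : restore T ρ b = T b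
  · rw [hb]
  · exact (h.isDualFirst (h.mem_of_restore_ne hb)).1.le

theorem SMInstance.IsDualCycle.restore_ne : restore T ρ ≠ T := by
  obtain ⟨p, hp⟩ := List.exists_mem_of_ne_nil _ h.1
  intro e
  have h1 := (h.isDualFirst hp).1
  rw [← e, h.restore_apply hp] at h1
  exact lt_irrefl _ h1

theorem SMInstance.IsDualCycle.mem_of_restore_symm_ne {g : Fin n}
    (hg : (restore T ρ).symm g ≠ T.symm g) : ((restore T ρ).symm g, g) ∈ ρ := by
  have := h.mem_of_restore_ne (b := (restore T ρ).symm g) (by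
    rw [Equiv.apply_symm_apply]
    intro e
    rw [Ne, Equiv.eq_symm_apply] at hg
    exact hg e.symm)
  rwa [Equiv.apply_symm_apply] at this

theorem SMInstance.IsDualCycle.restore_mem (hT : T ∈ A.stableMatchings) :
    restore T ρ ∈ A.stableMatchings := by
  rintro c g ⟨h1, h2⟩
  have h1 : A.boyRank c g < A.boyRank c (T c) := lt_of_lt_of_le h1 (h.dominates_restore c)
  have h3 := girlRank_lt_of_boyRank_lt hT h1
  have h4 := h.mem_of_restore_symm_ne fun e => by
    rw [← e] at h3
    exact lt_asymm h3 h2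
  exact (h.isDualFirst h4).2 c h2 h1

/-- A dual cycle of a stable matching `T` is a rotation exposed in the matching above. -/
theorem SMInstance.IsDualCycle.isExposed (hT : T ∈ A.stableMatchings) :
    A.IsExposed (restore T ρ) ρ := by
  refine ⟨h.restore_mem hT, h.1, h.2.1, fun p hp => h.restore_apply hp, fun i hi => ?_⟩
  have hj := Nat.mod_lt (i + 1) (Nat.zero_lt_of_lt hi)
  have e := (h.2.2 i hi).2
  have e' : (restore T ρ).symm (T ρ[i].1) = ρ[(i + 1) % ρ.length].1 := by
    rw [Equiv.symm_apply_eq, h.restore_apply (List.getElem_mem _), e]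
  refine ⟨T ρ[i].1, ⟨?_, fun g h1 h2 => ?_⟩, e'⟩
  · rw [e']
    have h1 := girlRank_lt_of_boyRank_lt hT (h.2.2 _ hj).1.1
    rwa [← e, T.symm_apply_apply] at h1
  · have h3 := girlRank_lt_of_boyRank_lt hT h1
    have h4 := h.mem_of_restore_symm_ne fun e => by
      rw [← e] at h3
      exact lt_asymm h3 h2
    exact (h.isDualFirst h4).2 _ h2 h1

end Cycle

/-! ### Dual cycles under an upper bound -/

section Step

variable (hN : N ∈ A.stableMatchings) (hNT : A.Dominates N T)
include hN hNT

omit hN in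
theorem girlRank_le_of_isDualFirst {g b : Fin n} (hg : N.symm g ≠ T.symm g)
    (h : A.IsDualFirst T g b) : A.girlRank g b ≤ A.girlRank g (N.symm g) := by
  refine not_lt.1 fun hlt => h.2 _ hlt (lt_of_le_of_ne ?_ ?_)
  · simpa using hNT (N.symm g)
  · rw [Ne, boyRank_inj, ← Equiv.symm_apply_eq]
    exact hg.symm

theorem boyRank_le_of_isDualFirst {g b : Fin n} (hg : N.symm g ≠ T.symm g)
    (h : A.IsDualFirst T g b) : A.boyRank b (N b) ≤ A.boyRank b g := by
  rcases (girlRank_le_of_isDualFirst hNT hg h).lt_or_eq with h1 | h1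
  · exact (boyRank_lt_of_girlRank_lt hN h1).le
  · rw [girlRank_inj] at h1
    rw [h1, N.apply_symm_apply]

theorem symm_ne_of_isDualFirst {g b : Fin n} (hg : N.symm g ≠ T.symm g)
    (h : A.IsDualFirst T g b) : N.symm (T b) ≠ T.symm (T b) := by
  rw [T.symm_apply_apply, Ne, Equiv.symm_apply_eq]
  intro e
  have h1 := boyRank_le_of_isDualFirst hN hNT hg h
  rw [← e] at h1
  exact absurd h.1 (not_lt.2 h1)

omit hN in
theorem exists_isDualFirst {g : Fin n} (hg : N.symm g ≠ T.symm g) :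
    ∃ b, A.IsDualFirst T g b := by
  obtain ⟨b, hb, hmin⟩ := Set.exists_min_image {b | A.boyRank b g < A.boyRank b (T b)}
    (A.girlRank g) (Set.toFinite _) ⟨N.symm g, lt_of_le_of_ne (by simpa using hNT (N.symm g)) (by
      rw [Ne, boyRank_inj, ← Equiv.symm_apply_eq]
      exact hg.symm)⟩
  exact ⟨b, hb, fun c hc h => absurd hc (not_lt.2 (hmin c h))⟩

/-- If the bound `N` differs from `T` on one girl of a dual cycle of `T`, then on all of them. -/
theorem SMInstance.IsDualCycle.symm_ne (h : A.IsDualCycle T ρ) {p q : Fin n × Fin n}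
    (hp : p ∈ ρ) (hq : q ∈ ρ) (hne : N.symm p.2 ≠ T.symm p.2) : N.symm q.2 ≠ T.symm q.2 := by
  obtain ⟨i, hi, rfl⟩ := List.getElem_of_mem hp
  obtain ⟨j, hj, rfl⟩ := List.getElem_of_mem hq
  have hpos : 0 < ρ.length := Nat.zero_lt_of_lt hi
  have key : ∀ k, N.symm (ρ[(i + k) % ρ.length]'(Nat.mod_lt _ hpos)).2 ≠
      T.symm (ρ[(i + k) % ρ.length]'(Nat.mod_lt _ hpos)).2 := by
    intro k
    induction k with
    | zero => simpa [Nat.mod_eq_of_lt hi] using hne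
    | succ k ih =>
      have h1 := h.2.2 _ (Nat.mod_lt (i + k) hpos)
      have h2 := symm_ne_of_isDualFirst hN hNT ih h1.1
      rw [h1.2] at h2
      simpa [Nat.mod_add_mod, add_assoc] using h2
  have h3 := key (j + ρ.length - i)
  have e : (i + (j + ρ.length - i)) % ρ.length = j := by
    rw [show i + (j + ρ.length - i) = j + ρ.length by omega, Nat.add_mod_right,
      Nat.mod_eq_of_lt hj]
  simpa only [e] using h3

/-- If the bound `N` agrees with `T` on one girl of a dual cycle of `T`, then this is a dual cycle
of `N`. -/
theorem SMInstance.IsDualCycle.persists (h : A.IsDualCycle T ρ) {p : Fin n × Fin n}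
    (hp : p ∈ ρ) (heq : N.symm p.2 = T.symm p.2) : A.IsDualCycle N ρ := by
  have key : ∀ q ∈ ρ, N.symm q.2 = T.symm q.2 := fun q hq => by
    by_contra hne
    exact h.symm_ne hN hNT hq hp hne heq
  refine ⟨h.1, h.2.1, fun i hi => ?_⟩
  have h1 := h.2.2 i hi
  have h2 := key _ (List.getElem_mem (Nat.mod_lt (i + 1) (Nat.zero_lt_of_lt hi)))
  rw [← h1.2, T.symm_apply_apply, Equiv.symm_apply_eq] at h2
  refine ⟨⟨?_, fun c hc h3 => h1.1.2 c hc (h3.trans_le (hNT c))⟩, ?_⟩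
  · rw [← h2]
    exact h1.1.1
  · rw [← h2, h1.2]

end Step

theorem SMInstance.IsDualCycle.rotate (h : A.IsDualCycle T ρ) (k : ℕ) :
    A.IsDualCycle T (ρ.rotate k) := by
  refine ⟨by simpa using h.1, by simpa using h.2.1, fun i hi => ?_⟩
  rw [List.length_rotate] at hi
  have h1 := h.2.2 _ (Nat.mod_lt (i + k) (Nat.zero_lt_of_lt hi))
  simp only [List.getElem_rotate, List.length_rotate]
  refine ⟨h1.1, h1.2.trans ?_⟩
  simp only [Nat.mod_add_mod]
  congr 3
  omega

theorem SMInstance.IsDualCycle.eq_of_head_eq (h : A.IsDualCycle T ρ) (h' : A.IsDualCycle T ρ')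
    (hl : ρ.length ≤ ρ'.length)
    (h0 : ρ[0]'(List.length_pos_iff.2 h.1) = ρ'[0]'(List.length_pos_iff.2 h'.1)) : ρ = ρ' := by
  have step : ∀ (i j : ℕ) (hi : i < ρ.length) (hj : j < ρ'.length), ρ[i] = ρ'[j] →
      ρ[(i + 1) % ρ.length]'(Nat.mod_lt _ (Nat.zero_lt_of_lt hi)) =
        ρ'[(j + 1) % ρ'.length]'(Nat.mod_lt _ (Nat.zero_lt_of_lt hj)) := by
    intro i j hi hj e
    have h1 := (h.2.2 i hi).2
    have h2 := (h'.2.2 j hj).2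
    rw [e, h2] at h1
    have h3 := (h.2.2 _ (Nat.mod_lt (i + 1) (Nat.zero_lt_of_lt hi))).1
    have h4 := (h'.2.2 _ (Nat.mod_lt (j + 1) (Nat.zero_lt_of_lt hj))).1
    rw [← h1] at h3
    exact Prod.ext (h3.unique h4) h1.symm
  have key : ∀ (i : ℕ) (hi : i < ρ.length), ρ[i] = ρ'[i]'(hi.trans_le hl) := by
    intro i
    induction i with
    | zero => exact fun _ => h0
    | succ i ih =>
      intro hi
      have := step i i (by omega) (by omega) (ih (by omega))
      simpa only [Nat.mod_eq_of_lt hi, Nat.mod_eq_of_lt (hi.trans_le hl)] using this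
  have hpos := List.length_pos_iff.2 h.1
  rcases hl.lt_or_eq with hlt | heq
  · have h1 := step (ρ.length - 1) (ρ.length - 1) (by omega) (by omega) (key _ (by omega))
    have e : ρ.length - 1 + 1 = ρ.length := by omega
    simp only [e, Nat.mod_self, Nat.mod_eq_of_lt hlt, h0] at h1
    rw [h'.2.1.getElem_inj_iff] at h1
    omega
  · exact List.ext_getElem heq fun i hi _ => key i hi

/-- Two dual cycles of `T` with a common girl agree up to a cyclic shift. -/
theorem SMInstance.IsDualCycle.isRotated (h : A.IsDualCycle T ρ) (h' : A.IsDualCycle T ρ')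
    {p q : Fin n × Fin n} (hp : p ∈ ρ) (hq : q ∈ ρ') (e : p.2 = q.2) : ρ ~r ρ' := by
  obtain ⟨i, hi, rfl⟩ := List.getElem_of_mem hp
  obtain ⟨j, hj, rfl⟩ := List.getElem_of_mem hq
  have h1 := (h.2.2 i hi).1
  rw [e] at h1
  have e' : ρ[i] = ρ'[j] := Prod.ext (h1.unique (h'.2.2 j hj).1) e
  have hr := h.rotate i
  have hr' := h'.rotate j
  have h0 : (ρ.rotate i)[0]'(List.length_pos_iff.2 hr.1) =
      (ρ'.rotate j)[0]'(List.length_pos_iff.2 hr'.1) := by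
    simpa [List.getElem_rotate, Nat.mod_eq_of_lt hi, Nat.mod_eq_of_lt hj] using e'
  have : ρ.rotate i = ρ'.rotate j := by
    rcases le_total (ρ.rotate i).length (ρ'.rotate j).length with hl | hl
    · exact hr.eq_of_head_eq hr' hl h0
    · exact (hr'.eq_of_head_eq hr hl h0.symm).symm
  exact (List.IsRotated.trans ⟨i, rfl⟩ (this ▸ List.IsRotated.symm ⟨j, rfl⟩))

/-- Two dual cycles of `T` with a common boy agree up to a cyclic shift. -/
theorem SMInstance.IsDualCycle.isRotated_of_fst_eq (h : A.IsDualCycle T ρ)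
    (h' : A.IsDualCycle T ρ') {p q : Fin n × Fin n} (hp : p ∈ ρ) (hq : q ∈ ρ')
    (e : p.1 = q.1) : ρ ~r ρ' := by
  obtain ⟨i, hi, rfl⟩ := List.getElem_of_mem hp
  obtain ⟨j, hj, rfl⟩ := List.getElem_of_mem hq
  have h1 := (h.2.2 i hi).2
  rw [e, (h'.2.2 j hj).2] at h1
  exact h.isRotated h' (List.getElem_mem _) (List.getElem_mem _) h1.symm

theorem SMInstance.IsExposed.of_isRotated (h : A.IsExposed M ρ) (hr : ρ ~r ρ') :
    A.IsExposed M ρ' := by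
  obtain ⟨k, rfl⟩ := hr
  refine ⟨h.1, by simpa using h.2.1, by simpa using h.2.2.1,
    fun p hp => h.2.2.2.1 p (by simpa using hp), fun i hi => ?_⟩
  rw [List.length_rotate] at hi
  have h1 := h.2.2.2.2 _ (Nat.mod_lt (i + k) (Nat.zero_lt_of_lt hi))
  simp only [List.getElem_rotate, List.length_rotate]
  convert h1 using 3
  simp only [Nat.mod_add_mod]
  congr 1
  omega

theorem SMInstance.IsExposed.eliminate_eq (h : A.IsExposed M ρ) (hr : ρ ~r ρ') :
    eliminate M ρ = eliminate M ρ' := by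
  rw [eliminate, eliminate, List.formPerm_eq_of_isRotated h.nodup_boys (hr.map _)]

/-! ### Rotations into and out of a window of the lattice -/

/-- The stable matchings in which the partner of `b` has at least position `k` on his list, and
the partner of `g` has at least position `l` on hers. -/
def window (A : SMInstance n) (b : Fin n) (k : ℕ) (g : Fin n) (l : ℕ) : Set (Matching n) :=
  {M | M ∈ A.stableMatchings ∧ k ≤ (A.boyRank b (M b) : ℕ) ∧ l ≤ (A.girlRank g (M.symm g) : ℕ)}

section Window

variable {b : Fin n} {k : ℕ} {g : Fin n} {l : ℕ}

theorem isTheRotationOf_rotationsInto {S : Set (Matching n)}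
    (hu : ∀ ρ' ∈ rotationsInto A S, ρ' ~r ρ) (h : ρ ∈ rotationsInto A S) :
    IsTheRotationOf (rotationsInto A S) (some ρ) := by
  refine fun ρ' => ⟨hu ρ', fun hr => ?_⟩
  obtain ⟨M, h1, h2, h3⟩ := h
  exact ⟨M, h1.of_isRotated hr.symm, h2, h1.eliminate_eq hr.symm ▸ h3⟩

theorem isTheRotationOf_rotationsOutOf {S : Set (Matching n)}
    (hu : ∀ ρ' ∈ rotationsOutOf A S, ρ' ~r ρ) (h : ρ ∈ rotationsOutOf A S) :
    IsTheRotationOf (rotationsOutOf A S) (some ρ) := by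
  refine fun ρ' => ⟨hu ρ', fun hr => ?_⟩
  obtain ⟨M, h1, h2, h3⟩ := h
  exact ⟨M, h1.of_isRotated hr.symm, h2, h1.eliminate_eq hr.symm ▸ h3⟩

/-- A rotation into the window moves `b` to a position from `k` on. -/
theorem boyRank_lt_of_mem_rotationsInto (h : A.IsExposed M ρ) (h1 : M ∉ window A b k g l)
    (h2 : eliminate M ρ ∈ window A b k g l) : (A.boyRank b (M b) : ℕ) < k := by
  by_contra! h3
  exact h1 ⟨h.1, h3, h2.2.2.trans (h.dominates.girlRank_le h2.1 g)⟩

/-- A rotation out of the window moves `g` to a position before `l`. -/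
theorem girlRank_lt_of_mem_rotationsOutOf (h : A.IsExposed M ρ) (h1 : M ∈ window A b k g l)
    (h2 : eliminate M ρ ∉ window A b k g l) :
    (A.girlRank g ((eliminate M ρ).symm g) : ℕ) < l := by
  by_contra! h3
  exact h2 ⟨h.eliminate_mem, h1.2.1.trans (h.dominates b), h3⟩

theorem isRotated_of_boyRank (h : A.IsExposed M ρ) (h' : A.IsExposed N ρ')
    (h1 : (A.boyRank b (M b) : ℕ) < k) (h2 : k ≤ (A.boyRank b (eliminate M ρ b) : ℕ))
    (h3 : (A.boyRank b (N b) : ℕ) < k) (h4 : k ≤ (A.boyRank b (eliminate N ρ' b) : ℕ)) :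
    ρ ~r ρ' := by
  obtain ⟨K, hK, hKM, hKN, hor⟩ := exists_join h.eliminate_mem h'.eliminate_mem
  have hKk : k ≤ (A.boyRank b (K b) : ℕ) := by
    rcases hor b with e | e <;> rw [e] <;> assumption
  have key : ∀ {L : Matching n} {π : List (Fin n × Fin n)}, A.IsExposed L π →
      A.Dominates K (eliminate L π) → (A.boyRank b (L b) : ℕ) < k →
      k ≤ (A.boyRank b (eliminate L π b) : ℕ) → A.IsDualCycle K π ∧ ∃ p ∈ π, p.1 = b := by
    intro L π hL hd hlt hle
    have hm : b ∈ π.map Prod.fst := by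
      by_contra hm
      rw [eliminate_of_notMem hm] at hle
      omega
    obtain ⟨p, hp, rfl⟩ := List.mem_map.1 hm
    refine ⟨hL.isDualCycle.persists hK hd hp ?_, p, hp, rfl⟩
    by_contra hne
    have h5 := boyRank_le_of_isDualFirst hK hd hne (hL.isDualCycle.isDualFirst hp)
    rw [← hL.2.2.2.1 p hp, Fin.le_def] at h5
    omega
  obtain ⟨c, p, hp, rfl⟩ := key h hKM h1 h2
  obtain ⟨c', q, hq, e⟩ := key h' hKN h3 h4
  exact c.isRotated_of_fst_eq c' hp hq e.symm

theorem isRotated_of_girlRank (h : A.IsExposed M ρ) (h' : A.IsExposed N ρ')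
    (h1 : l ≤ (A.girlRank g (M.symm g) : ℕ))
    (h2 : (A.girlRank g ((eliminate M ρ).symm g) : ℕ) < l)
    (h3 : l ≤ (A.girlRank g (N.symm g) : ℕ))
    (h4 : (A.girlRank g ((eliminate N ρ').symm g) : ℕ) < l) : ρ ~r ρ' := by
  obtain ⟨K, hK, hKM, hKN, hor⟩ := exists_join h.eliminate_mem h'.eliminate_mem
  have hKl : (A.girlRank g (K.symm g) : ℕ) < l := by
    rcases hor (K.symm g) with e | e <;>
    · rw [K.apply_symm_apply, ← Equiv.symm_apply_eq] at e
      rw [← e]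
      assumption
  have key : ∀ {L : Matching n} {π : List (Fin n × Fin n)}, A.IsExposed L π →
      A.Dominates K (eliminate L π) → l ≤ (A.girlRank g (L.symm g) : ℕ) →
      (A.girlRank g ((eliminate L π).symm g) : ℕ) < l →
      A.IsDualCycle K π ∧ ∃ p ∈ π, p.2 = g := by
    intro L π hL hd hle hlt
    have hm : L.symm g ∈ π.map Prod.fst := by
      by_contra hm
      have e := eliminate_of_notMem (M := L) hm
      rw [L.apply_symm_apply, ← Equiv.eq_symm_apply] at e
      rw [← e] at hlt
      omega
    obtain ⟨p, hp, hpg⟩ := List.mem_map.1 hm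
    have hp2 : p.2 = g := by
      rw [← hL.2.2.2.1 p hp, hpg, L.apply_symm_apply]
    subst hp2
    refine ⟨hL.isDualCycle.persists hK hd hp ?_, p, hp, rfl⟩
    by_contra hne
    have h5 := girlRank_le_of_isDualFirst hd hne (hL.isDualCycle.isDualFirst hp)
    rw [hpg, Fin.le_def] at h5
    omega
  obtain ⟨c, p, hp, rfl⟩ := key h hKM h1 h2
  obtain ⟨c', q, hq, e⟩ := key h' hKN h3 h4
  exact c.isRotated c' hp hq e.symm

end Window

/-! ### The rotation that leads to a given matching -/

open Classical in
/-- The first boy on the list of `g` who strictly prefers `g` to his `T`-partner. -/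
noncomputable def dualFirst (A : SMInstance n) (T : Matching n) (g : Fin n) : Fin n :=
  if h : ∃ b, A.IsDualFirst T g b then h.choose else g

/-- The `T`-partner of this boy. -/
noncomputable def dualNext (A : SMInstance n) (T : Matching n) (g : Fin n) : Fin n :=
  T (dualFirst A T g)

/-- The orbit of `g` under `dualNext`, with the boys on the way. -/
noncomputable def dualOrbit (A : SMInstance n) (T : Matching n) (g : Fin n) :
    List (Fin n × Fin n) :=
  (List.range (minimalPeriod (dualNext A T) g)).map fun i =>
    (dualFirst A T ((dualNext A T)^[i] g), (dualNext A T)^[i] g)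

theorem SMInstance.IsDualFirst.dualFirst_eq {g b : Fin n} (h : A.IsDualFirst T g b) :
    dualFirst A T g = b := by
  have h' : ∃ b, A.IsDualFirst T g b := ⟨b, h⟩
  rw [dualFirst, dif_pos h']
  exact h'.choose_spec.unique h

section Orbit

variable (hN : N ∈ A.stableMatchings) (hNT : A.Dominates N T)
include hN hNT

omit hN in
theorem isDualFirst_dualFirst {g : Fin n} (hg : N.symm g ≠ T.symm g) :
    A.IsDualFirst T g (dualFirst A T g) := by
  obtain ⟨b, hb⟩ := exists_isDualFirst hNT hg
  rwa [hb.dualFirst_eq]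

theorem symm_iterate_dualNext_ne {g : Fin n} (hg : N.symm g ≠ T.symm g) (i : ℕ) :
    N.symm ((dualNext A T)^[i] g) ≠ T.symm ((dualNext A T)^[i] g) := by
  induction i with
  | zero => exact hg
  | succ i ih =>
    rw [iterate_succ_apply']
    exact symm_ne_of_isDualFirst hN hNT ih (isDualFirst_dualFirst hNT ih)

theorem isDualCycle_dualOrbit {g : Fin n} (hg : N.symm g ≠ T.symm g)
    (hp : g ∈ periodicPts (dualNext A T)) : A.IsDualCycle T (dualOrbit A T g) := by
  have hpos := minimalPeriod_pos_of_mem_periodicPts hp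
  refine ⟨by simpa [dualOrbit] using hpos.ne', ?_, fun i hi => ?_⟩
  · refine List.Nodup.map_on (fun i hi j hj e => ?_) List.nodup_range
    exact iterate_injOn_Iio_minimalPeriod (List.mem_range.1 hi) (List.mem_range.1 hj)
      (congrArg Prod.snd e)
  · simp only [dualOrbit, List.getElem_map, List.getElem_range, List.length_map,
      List.length_range]
    refine ⟨isDualFirst_dualFirst hNT (symm_iterate_dualNext_ne hN hNT hg i), ?_⟩
    rw [iterate_mod_minimalPeriod_eq, iterate_succ_apply']
    rfl

theorem dominates_restore_dualOrbit {g : Fin n} (hg : N.symm g ≠ T.symm g)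
    (hp : g ∈ periodicPts (dualNext A T)) : A.Dominates N (restore T (dualOrbit A T g)) := by
  have hc := isDualCycle_dualOrbit hN hNT hg hp
  intro b
  by_cases hb : restore T (dualOrbit A T g) b = T b
  · rw [hb]
    exact hNT b
  · have hm := hc.mem_of_restore_ne hb
    refine boyRank_le_of_isDualFirst hN hNT ?_ (hc.isDualFirst hm)
    simp only [dualOrbit, List.mem_map, List.mem_range, Prod.mk.injEq] at hm
    obtain ⟨m, -, -, hm⟩ := hm
    simp only [dualOrbit]
    rw [← hm]
    exact symm_iterate_dualNext_ne hN hNT hg m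

/-- If all stable matchings strictly between `T` and `N` differ from `T` at `g`, then `g` is on a
dual cycle of `T`. -/
theorem mem_periodicPts_dualNext (hT : T ∈ A.stableMatchings) {g : Fin n} (hne : N ≠ T)
    (h : ∀ M ∈ A.stableMatchings, A.Dominates N M → A.Dominates M T → M ≠ T →
      M.symm g ≠ T.symm g) :
    g ∈ periodicPts (dualNext A T) := by
  have hg := h N hN (fun _ => le_rfl) hNT hne
  obtain ⟨i, j, hij, e⟩ :=
    Finite.exists_ne_map_eq_of_infinite fun i => (dualNext A T)^[i] g
  wlog hlt : i < j generalizing i j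
  · exact this j i hij.symm e.symm (by omega)
  have hp : (dualNext A T)^[i] g ∈ periodicPts (dualNext A T) := by
    refine ⟨j - i, by omega, ?_⟩
    rw [IsPeriodicPt, IsFixedPt, ← iterate_add_apply, Nat.sub_add_cancel hlt.le]
    exact e.symm
  have hc := isDualCycle_dualOrbit hN hNT (symm_iterate_dualNext_ne hN hNT hg i) hp
  have hm := hc.mem_of_restore_symm_ne
    (h _ (hc.restore_mem hT) (dominates_restore_dualOrbit hN hNT
      (symm_iterate_dualNext_ne hN hNT hg i) hp) hc.dominates_restore hc.restore_ne)
  simp only [dualOrbit, List.mem_map, List.mem_range, Prod.mk.injEq] at hm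
  obtain ⟨m, -, -, hm⟩ := hm
  rw [← hm]
  obtain ⟨q, hq, hq'⟩ := hp
  exact ⟨q, hq, hq'.apply_iterate m⟩

end Orbit

/-- `T` is the best matching for the boys in the set `S`. -/
def SMInstance.IsTop (A : SMInstance n) (S : Set (Matching n)) (T : Matching n) : Prop :=
  T ∈ S ∧ ∀ M ∈ S, A.Dominates T M

section Compute

variable {b : Fin n} {k : ℕ} {g : Fin n} {l : ℕ}

theorem isTheRotationOf_none_of_eq_empty (h : window A b k g l = ∅) :
    IsTheRotationOf (rotationsInto A (window A b k g l)) none ∧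
      IsTheRotationOf (rotationsOutOf A (window A b k g l)) none := by
  rw [h]
  constructor <;> ext ρ <;> simp [rotationsInto, rotationsOutOf]

theorem isTheRotationOf_rotationsInto_none
    (h : ∀ M ∈ A.stableMatchings, k ≤ (A.boyRank b (M b) : ℕ)) :
    IsTheRotationOf (rotationsInto A (window A b k g l)) none := by
  ext ρ
  simp only [Set.mem_empty_iff_false, iff_false]
  rintro ⟨M, h1, h2, h3⟩
  exact absurd (boyRank_lt_of_mem_rotationsInto h1 h2 h3) (not_lt.2 (h M h1.1))

theorem isTheRotationOf_rotationsOutOf_none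
    (h : ∀ M ∈ A.stableMatchings, k ≤ (A.boyRank b (M b) : ℕ) →
      l ≤ (A.girlRank g (M.symm g) : ℕ)) :
    IsTheRotationOf (rotationsOutOf A (window A b k g l)) none := by
  ext ρ
  simp only [Set.mem_empty_iff_false, iff_false]
  rintro ⟨M, h1, h2, h3⟩
  exact absurd (girlRank_lt_of_mem_rotationsOutOf h1 h2 h3)
    (not_lt.2 (h _ h1.eliminate_mem (h2.2.1.trans (h1.dominates b))))

theorem isTheRotationOf_rotationsInto_dualOrbit
    (hT : A.IsTop {M | M ∈ A.stableMatchings ∧ k ≤ (A.boyRank b (M b) : ℕ)} T)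
    (hl : l ≤ (A.girlRank g (T.symm g) : ℕ)) (hN : N ∈ A.stableMatchings)
    (hNT : A.Dominates N T) (hNk : (A.boyRank b (N b) : ℕ) < k) :
    T b ∈ periodicPts (dualNext A T) ∧ A.IsDualCycle T (dualOrbit A T (T b)) ∧
      IsTheRotationOf (rotationsInto A (window A b k g l)) (some (dualOrbit A T (T b))) := by
  obtain ⟨⟨hTs, hTk⟩, hTtop⟩ := hT
  have hlt : ∀ M ∈ A.stableMatchings, A.Dominates M T → M ≠ T →
      (A.boyRank b (M b) : ℕ) < k := by
    intro M hM hMT hne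
    by_contra! h
    exact hne (hMT.antisymm (hTtop M ⟨hM, h⟩))
  have hne : ∀ M ∈ A.stableMatchings, A.Dominates M T → M ≠ T →
      M.symm (T b) ≠ T.symm (T b) := by
    intro M hM hMT hne e
    have h1 := hlt M hM hMT hne
    rw [T.symm_apply_apply, Equiv.symm_apply_eq] at e
    rw [← e] at h1
    omega
  have hN' : N ≠ T := by
    rintro rfl
    omega
  have hp := mem_periodicPts_dualNext hN hNT hTs hN' fun M hM _ => hne M hM
  have hc := isDualCycle_dualOrbit hN hNT (hne N hN hNT hN') hp
  have hlt' := hlt _ (hc.restore_mem hTs) hc.dominates_restore hc.restore_ne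
  refine ⟨hp, hc, isTheRotationOf_rotationsInto ?_
    ⟨restore T (dualOrbit A T (T b)), hc.isExposed hTs, fun h => ?_, ?_⟩⟩
  · rintro ρ' ⟨M, h1, h2, h3⟩
    refine isRotated_of_boyRank h1 (hc.isExposed hTs) (boyRank_lt_of_mem_rotationsInto h1 h2 h3)
      h3.2.1 hlt' ?_
    rwa [eliminate_restore]
  · exact absurd h.2.1 (not_le.2 hlt')
  · rw [eliminate_restore]
    exact ⟨hTs, hTk, hl⟩

theorem isTheRotationOf_rotationsOutOf_dualOrbit
    (hT : A.IsTop {M | M ∈ A.stableMatchings ∧ k ≤ (A.boyRank b (M b) : ℕ) ∧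
      (A.girlRank g (M.symm g) : ℕ) < l} T)
    (hN : N ∈ A.stableMatchings) (hNk : k ≤ (A.boyRank b (N b) : ℕ))
    (hNl : l ≤ (A.girlRank g (N.symm g) : ℕ)) (hNT : A.Dominates N T) :
    g ∈ periodicPts (dualNext A T) ∧ A.IsDualCycle T (dualOrbit A T g) ∧
      IsTheRotationOf (rotationsOutOf A (window A b k g l)) (some (dualOrbit A T g)) := by
  obtain ⟨⟨hTs, hTk, hTl⟩, hTtop⟩ := hT
  have hle : ∀ M ∈ A.stableMatchings, A.Dominates N M → A.Dominates M T → M ≠ T →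
      k ≤ (A.boyRank b (M b) : ℕ) ∧ l ≤ (A.girlRank g (M.symm g) : ℕ) := by
    intro M hM hNM hMT hne
    have hMk : k ≤ (A.boyRank b (M b) : ℕ) := hNk.trans (hNM b)
    refine ⟨hMk, ?_⟩
    by_contra! h
    exact hne (hMT.antisymm (hTtop M ⟨hM, hMk, h⟩))
  have hne : ∀ M ∈ A.stableMatchings, A.Dominates N M → A.Dominates M T → M ≠ T →
      M.symm g ≠ T.symm g := by
    intro M hM hNM hMT hne e
    have h1 := (hle M hM hNM hMT hne).2
    rw [e] at h1
    omega
  have hN' : N ≠ T := by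
    rintro rfl
    omega
  have hg := hne N hN (fun _ => le_rfl) hNT hN'
  have hp := mem_periodicPts_dualNext hN hNT hTs hN' hne
  have hc := isDualCycle_dualOrbit hN hNT hg hp
  have hle' := hle _ (hc.restore_mem hTs) (dominates_restore_dualOrbit hN hNT hg hp)
    hc.dominates_restore hc.restore_ne
  refine ⟨hp, hc, isTheRotationOf_rotationsOutOf ?_
    ⟨restore T (dualOrbit A T g), hc.isExposed hTs, ⟨hc.restore_mem hTs, hle'⟩, ?_⟩⟩
  · rintro ρ' ⟨M, h1, h2, h3⟩
    refine isRotated_of_girlRank h1 (hc.isExposed hTs) h2.2.2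
      (girlRank_lt_of_mem_rotationsOutOf h1 h2 h3) hle'.2 ?_
    rwa [eliminate_restore]
  · rw [eliminate_restore]
    exact fun h => absurd h.2.2 (not_le.2 hTl)

end Compute

/-! ### Shifts -/

section Shift

variable {i j p q : Fin n}

theorem cycleIcc_lt_iff (hp : p ≠ j) (hq : q ≠ j) :
    Fin.cycleIcc i j p < Fin.cycleIcc i j q ↔ p < q := by
  have : NeZero n := ⟨by have := p.2; omega⟩
  have key : ∀ r, r ≠ j → (Fin.cycleIcc i j r : ℕ) = if i ≤ r ∧ r < j then (r : ℕ) + 1 else r := by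
    intro r hr
    split_ifs with h
    · rw [Fin.cycleIcc_of_ge_of_lt h.1 h.2, Fin.val_add_one_of_lt' (by have := h.2; omega)]
    · rcases lt_or_ge r i with h1 | h1
      · rw [Fin.cycleIcc_of_lt h1]
      · rw [Fin.cycleIcc_of_gt (lt_of_le_of_ne (not_lt.1 fun h2 => h ⟨h1, h2⟩) hr.symm)]
  rw [Fin.lt_def, key p hp, key q hq]
  simp only [Fin.le_def, Fin.lt_def, Ne, Fin.ext_iff] at *
  split_ifs <;> omega

theorem cycleIcc_last_lt_iff (h : i < j) (hp : p < j) :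
    Fin.cycleIcc i j j < Fin.cycleIcc i j p ↔ i ≤ p := by
  have : NeZero n := ⟨by have := p.2; omega⟩
  rw [Fin.cycleIcc_of_last h.le]
  rcases lt_or_ge p i with h1 | h1
  · rw [Fin.cycleIcc_of_lt h1]
    exact iff_of_false (not_lt.2 h1.le) (not_le.2 h1)
  · rw [Fin.cycleIcc_of_ge_of_lt h1 hp, Fin.lt_def, Fin.val_add_one_of_lt' (by omega)]
    exact iff_of_true (by have := Fin.le_def.1 h1; omega) h1

theorem lt_of_cycleIcc_lt_last (h : i < j) (hp : Fin.cycleIcc i j p < Fin.cycleIcc i j j) :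
    p < j := by
  have : NeZero n := ⟨by have := p.2; omega⟩
  rw [Fin.cycleIcc_of_last h.le] at hp
  by_contra! hle
  rcases hle.lt_or_eq with h1 | rfl
  · rw [Fin.cycleIcc_of_gt h1] at hp
    exact absurd (h.trans h1) (not_lt.2 hp.le)
  · rw [Fin.cycleIcc_of_last h.le] at hp
    exact lt_irrefl _ hp

theorem shiftList_symm_apply (L : Equiv.Perm (Fin n)) (x : Fin n) :
    (shiftList L i j).symm x = Fin.cycleIcc i j (L.symm x) := by
  simp [shiftList]

/-- A preference that the shift creates is that of the moved entry over an entry between its new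
and its old position. -/
theorem shiftList_gain (L : Equiv.Perm (Fin n)) (h : i < j) {x y : Fin n} :
    ((shiftList L i j).symm x < (shiftList L i j).symm y ∧ ¬ L.symm x < L.symm y) ↔
      x = L j ∧ i ≤ L.symm y ∧ L.symm y < j := by
  rw [shiftList_symm_apply, shiftList_symm_apply]
  constructor
  · rintro ⟨h1, h2⟩
    by_cases hx : L.symm x = j
    · rw [hx] at h1 h2
      have hy : L.symm y ≠ j := fun e => by simp [e] at h1
      have hy' := lt_of_le_of_ne (not_lt.1 h2) hy
      exact ⟨by rw [← hx, L.apply_symm_apply], (cycleIcc_last_lt_iff h hy').1 h1, hy'⟩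
    · by_cases hy : L.symm y = j
      · rw [hy] at h1 h2
        exact absurd (lt_of_cycleIcc_lt_last h h1) h2
      · exact absurd ((cycleIcc_lt_iff hx hy).1 h1) h2
  · rintro ⟨rfl, h1, h2⟩
    rw [L.symm_apply_apply]
    exact ⟨(cycleIcc_last_lt_iff h h2).2 h1, not_lt.2 h2.le⟩

theorem lostMatchings_girl (g : Fin n) (h : i < j) :
    lostMatchings A (A.applyShift (.girl g i j h)) =
      window A (A.girlList g j) ((A.boyRank (A.girlList g j) g : ℕ) + 1) g i := by
  ext M
  constructor
  · rintro ⟨hM, hB⟩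
    simp only [stableMatchings, Set.mem_ofPred_eq, not_forall, not_not] at hB
    obtain ⟨b, g', h1, h2⟩ := hB
    have h1 : A.BoyPrefers b g' (M b) := h1
    have hg : g' = g := by
      by_contra hg
      refine hM b g' ⟨h1, ?_⟩
      simpa [GirlPrefers, applyShift, hg] using h2
    subst hg
    have h3 : ¬ A.GirlPrefers g' b (M.symm g') := fun h3 => hM b g' ⟨h1, h3⟩
    simp only [GirlPrefers, applyShift, update_self] at h2 h3
    obtain ⟨rfl, h4, h5⟩ := (shiftList_gain _ h).1 ⟨h2, h3⟩
    exact ⟨hM, h1, h4⟩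
  · rintro ⟨hM, h1, h2⟩
    refine ⟨hM, fun hB => hB (A.girlList g j) g ⟨h1, ?_⟩⟩
    simp only [GirlPrefers, applyShift, update_self]
    refine ((shiftList_gain _ h).2 ⟨rfl, h2, ?_⟩).1
    have := girlRank_lt_of_boyRank_lt hM (b := A.girlList g j) (g := g) h1
    simpa [girlRank] using this

theorem lostMatchings_boy (b : Fin n) (h : i < j) :
    lostMatchings A (A.applyShift (.boy b i j h)) =
      window A b i (A.boyList b j) ((A.girlRank (A.boyList b j) b : ℕ) + 1) := by
  ext M
  constructor
  · rintro ⟨hM, hB⟩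
    simp only [stableMatchings, Set.mem_ofPred_eq, not_forall, not_not] at hB
    obtain ⟨b', g, h1, h2⟩ := hB
    have h2 : A.GirlPrefers g b' (M.symm g) := h2
    have hb : b' = b := by
      by_contra hb
      refine hM b' g ⟨?_, h2⟩
      simpa [BoyPrefers, applyShift, hb] using h1
    subst hb
    have h3 : ¬ A.BoyPrefers b' g (M b') := fun h3 => hM b' g ⟨h3, h2⟩
    simp only [BoyPrefers, applyShift, update_self] at h1 h3
    obtain ⟨rfl, h4, h5⟩ := (shiftList_gain _ h).1 ⟨h1, h3⟩
    exact ⟨hM, h4, h2⟩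
  · rintro ⟨hM, h1, h2⟩
    refine ⟨hM, fun hB => hB b (A.boyList b j) ⟨?_, h2⟩⟩
    simp only [BoyPrefers, applyShift, update_self]
    refine ((shiftList_gain _ h).2 ⟨rfl, h1, ?_⟩).1
    have := boyRank_lt_of_girlRank_lt hM (b := b) (g := A.boyList b j) h2
    simpa [boyRank] using this

end Shift

end StableMatching

/-! ### The best stable matching under lower bounds -/

namespace StableMatching

open SMInstance Function

variable {n : ℕ} {A : SMInstance n} {b : Fin n} {k : ℕ} {g : Fin n} {l : ℕ}

/-- The stable matchings in which the partner of `b` has at least position `k` on his list, and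
the partner of `g` has a position before `l` on hers. -/
def constrained (A : SMInstance n) (b : Fin n) (k : ℕ) (g : Fin n) (l : ℕ) : Set (Matching n) :=
  {M | M ∈ A.stableMatchings ∧ k ≤ (A.boyRank b (M b) : ℕ) ∧ (A.girlRank g (M.symm g) : ℕ) < l}

/-- When the boys have come down to the positions `p` of their lists, then boy `c` cannot stay with
the girl `h`. -/
def MustLeave (A : SMInstance n) (b : Fin n) (k : ℕ) (g : Fin n) (l : ℕ) (p : Fin n → ℕ)
    (c h : Fin n) : Prop :=
  (c = b ∧ p c < k) ∨ (h = g ∧ l ≤ (A.girlRank h c : ℕ)) ∨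
    ∃ d, (A.boyRank d h : ℕ) ≤ p d ∧ A.girlRank h d < A.girlRank h c

open Classical in
/-- Boy `c` moves on by one position if he cannot stay. -/
noncomputable def advance (A : SMInstance n) (b : Fin n) (k : ℕ) (g : Fin n) (l : ℕ)
    (p : Fin n → ℕ) (c : Fin n) : Fin n → ℕ :=
  if ∃ h : p c < n, MustLeave A b k g l p c (A.boyList c ⟨p c, h⟩) then update p c (p c + 1) else p

/-- The boys before `i` move on in turn. -/
noncomputable def sweepUpTo (A : SMInstance n) (b : Fin n) (k : ℕ) (g : Fin n) (l : ℕ)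
    (p : Fin n → ℕ) : ℕ → Fin n → ℕ
  | 0 => p
  | i + 1 => if h : i < n then advance A b k g l (sweepUpTo A b k g l p i) ⟨i, h⟩
    else sweepUpTo A b k g l p i

/-- All boys move on in turn. -/
noncomputable def sweep (A : SMInstance n) (b : Fin n) (k : ℕ) (g : Fin n) (l : ℕ)
    (p : Fin n → ℕ) : Fin n → ℕ :=
  sweepUpTo A b k g l p n

theorem le_advance (p : Fin n → ℕ) (c : Fin n) : p ≤ advance A b k g l p c := by
  intro d
  rw [advance]
  split_ifs
  · rw [update_apply]
    split_ifs with h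
    · rw [h]
      exact Nat.le_succ _
    · exact le_rfl
  · exact le_rfl

theorem sweepUpTo_mono (p : Fin n → ℕ) : Monotone (sweepUpTo A b k g l p) := by
  refine monotone_nat_of_le_succ fun i => ?_
  rw [sweepUpTo]
  split_ifs
  · exact le_advance _ _
  · exact le_rfl

theorem le_sweep (p : Fin n → ℕ) : p ≤ sweep A b k g l p :=
  sweepUpTo_mono p (Nat.zero_le n)

theorem advance_eq_of_sweep_eq {p : Fin n → ℕ} (h : sweep A b k g l p = p) (c : Fin n) :
    advance A b k g l p c = p := by
  have h1 : ∀ i ≤ n, sweepUpTo A b k g l p i = p := fun i hi =>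
    le_antisymm ((sweepUpTo_mono p hi).trans h.le) (sweepUpTo_mono p (Nat.zero_le i))
  have h2 := h1 (c + 1) c.2
  rwa [sweepUpTo, dif_pos c.2, h1 c c.2.le] at h2

theorem advance_le {p q : Fin n → ℕ} (hp : p ≤ q)
    (hq : ∀ c (h : p c < n), MustLeave A b k g l p c (A.boyList c ⟨p c, h⟩) → p c ≠ q c)
    (c : Fin n) : advance A b k g l p c ≤ q := by
  intro d
  rw [advance]
  split_ifs with h
  · rw [update_apply]
    split_ifs with hd
    · obtain ⟨h1, h2⟩ := h
      rw [hd]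
      exact lt_of_le_of_ne (hp c) (hq c h1 h2)
    · exact hp d
  · exact hp d

theorem sweep_le {q : Fin n → ℕ} (hq : ∀ p ≤ q, ∀ c (h : p c < n),
      MustLeave A b k g l p c (A.boyList c ⟨p c, h⟩) → p c ≠ q c)
    {p : Fin n → ℕ} (hp : p ≤ q) : sweep A b k g l p ≤ q := by
  have : ∀ i, sweepUpTo A b k g l p i ≤ q := by
    intro i
    induction i with
    | zero => exact hp
    | succ i ih =>
      rw [sweepUpTo]
      split_ifs
      · exact advance_le ih (hq _ ih) _
      · exact ih
  exact this n

theorem iterate_sweep_le {q : Fin n → ℕ} (hq : ∀ p ≤ q, ∀ c (h : p c < n),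
      MustLeave A b k g l p c (A.boyList c ⟨p c, h⟩) → p c ≠ q c) (i : ℕ) :
    (sweep A b k g l)^[i] 0 ≤ q := by
  induction i with
  | zero => exact fun _ => Nat.zero_le _
  | succ i ih =>
    rw [iterate_succ_apply']
    exact sweep_le hq ih

/-- An inflationary map on bounded functions reaches a fixed point. -/
theorem isFixedPt_iterate_of_le {f : (Fin n → ℕ) → Fin n → ℕ} (hf : ∀ p, p ≤ f p)
    (hb : ∀ i, f^[i] 0 ≤ fun _ => n) : f (f^[n * n] 0) = f^[n * n] 0 := by
  have key : ∀ i, f (f^[i] 0) = f^[i] 0 ∨ i ≤ ∑ c, f^[i] 0 c := by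
    intro i
    induction i with
    | zero => exact .inr (Nat.zero_le _)
    | succ i ih =>
      rw [iterate_succ_apply']
      by_cases h : f (f^[i] 0) = f^[i] 0
      · exact .inl (by rw [h, h])
      · refine .inr ?_
        have h1 := ih.resolve_left h
        obtain ⟨c, hc⟩ := Function.ne_iff.1 h
        have h2 : ∑ c, f^[i] 0 c < ∑ c, f (f^[i] 0) c :=
          Finset.sum_lt_sum (fun d _ => hf _ d)
            ⟨c, Finset.mem_univ c, lt_of_le_of_ne (hf _ c) (Ne.symm hc)⟩
        omega
  rcases key (n * n) with h | h
  · exact h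
  · have h1 : ∀ c, f^[n * n] 0 c = n := by
      by_contra! hne
      obtain ⟨c, hc⟩ := hne
      have h2 : ∑ c, f^[n * n] 0 c < ∑ _c : Fin n, n :=
        Finset.sum_lt_sum (fun d _ => hb _ d)
          ⟨c, Finset.mem_univ c, lt_of_le_of_ne (hb _ c) hc⟩
      simp only [Finset.sum_const, Finset.card_univ, Fintype.card_fin, smul_eq_mul] at h2
      omega
    refine le_antisymm (fun c => ?_) (hf _)
    rw [h1 c, ← iterate_succ_apply' f]
    exact hb _ c

/-- The positions of the boys after sufficiently many rounds. -/
noncomputable def finalPositions (A : SMInstance n) (b : Fin n) (k : ℕ) (g : Fin n) (l : ℕ) :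
    Fin n → ℕ :=
  (sweep A b k g l)^[n * n] 0

theorem finalPositions_le_boyRank {M : Matching n} (hM : M ∈ constrained A b k g l) (c : Fin n) :
    finalPositions A b k g l c ≤ A.boyRank c (M c) := by
  refine iterate_sweep_le (q := fun c => A.boyRank c (M c)) ?_ _ c
  intro p hp c h hleave e
  have e' : A.boyList c ⟨p c, h⟩ = M c := by
    have : (⟨p c, h⟩ : Fin n) = A.boyRank c (M c) := Fin.ext e
    rw [this, boyRank, Equiv.apply_symm_apply]
  rw [e'] at hleave
  obtain ⟨h1, h2, h3⟩ := hM
  rcases hleave with ⟨rfl, h4⟩ | ⟨rfl, h4⟩ | ⟨d, h4, h5⟩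
  · have : p c = A.boyRank c (M c) := e
    omega
  · rw [M.symm_apply_apply] at h3
    omega
  · have h6 : M d ≠ M c := fun h => by
      rw [M.injective h] at h5
      exact lt_irrefl _ h5
    have h7 : A.boyRank d (M c) ≤ A.boyRank d (M d) := Fin.le_def.2 (h4.trans (hp d))
    have h8 := girlRank_lt_of_boyRank_lt h1
      (lt_of_le_of_ne h7 fun h => h6 (boyRank_inj.1 h).symm)
    rw [M.symm_apply_apply] at h8
    exact lt_asymm h5 h8

theorem not_mustLeave_finalPositions (c : Fin n) (h : finalPositions A b k g l c < n) :
    ¬ MustLeave A b k g l (finalPositions A b k g l) c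
      (A.boyList c ⟨finalPositions A b k g l c, h⟩) := by
  intro hm
  have h1 : sweep A b k g l (finalPositions A b k g l) = finalPositions A b k g l :=
    isFixedPt_iterate_of_le le_sweep
      fun i => iterate_sweep_le (q := fun _ => n) (fun _ _ _ h _ => h.ne) i
  have h2 := congrFun (advance_eq_of_sweep_eq h1 c) c
  rw [advance, if_pos ⟨h, hm⟩, update_self] at h2
  omega

/-- The final positions are those of the best matching for the boys, unless some boy has come to
the end of his list. -/
theorem finalPositions_spec :
    ((∀ c, finalPositions A b k g l c < n) ∧ ∃ T, A.IsTop (constrained A b k g l) T ∧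
      ∀ c, finalPositions A b k g l c = A.boyRank c (T c)) ∨
    ((∃ c, n ≤ finalPositions A b k g l c) ∧ constrained A b k g l = ∅) := by
  by_cases hlt : ∀ c, finalPositions A b k g l c < n
  · refine .inl ⟨hlt, ?_⟩
    set p := finalPositions A b k g l with hp
    let f : Fin n → Fin n := fun c => A.boyList c ⟨p c, hlt c⟩
    have hrank : ∀ c, (A.boyRank c (f c) : ℕ) = p c := fun c => by
      simp only [f, boyRank, Equiv.symm_apply_apply]
    have hnot := fun c => not_mustLeave_finalPositions (A := A) (b := b) (k := k) (g := g)
      (l := l) c (hlt c)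
    have hnot : ∀ c, ¬ MustLeave A b k g l p c (f c) := hnot
    have hstay : ∀ c d, (A.boyRank d (f c) : ℕ) ≤ p d →
        A.girlRank (f c) c ≤ A.girlRank (f c) d := fun c d h => by
      by_contra! hlt
      exact hnot c (.inr (.inr ⟨d, h, hlt⟩))
    have hinj : Injective f := fun c d e => by
      have h1 := hstay c d (by rw [e, hrank])
      have h2 := hstay d c (by rw [← e, hrank])
      rw [← e] at h2
      exact girlRank_inj.1 (le_antisymm h1 h2)
    let T : Matching n := Equiv.ofBijective f (Finite.injective_iff_bijective.1 hinj)
    have hT : ∀ c, T c = f c := fun _ => rfl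
    refine ⟨T, ⟨⟨?_, ?_, ?_⟩, fun M hM c => ?_⟩, fun c => (hrank c).symm⟩
    · rintro c h ⟨h1, h2⟩
      have h1 : A.boyRank c h < A.boyRank c (f c) := h1
      have h2 : A.girlRank h c < A.girlRank h (T.symm h) := h2
      have h3 : f (T.symm h) = h := T.apply_symm_apply h
      have h4 := hstay (T.symm h) c (by
        rw [h3, ← hrank]
        exact (Fin.lt_def.1 h1).le)
      rw [h3] at h4
      exact absurd h2 (not_lt.2 h4)
    · rw [hT, hrank]
      by_contra! h
      exact hnot b (.inl ⟨rfl, h⟩)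
    · by_contra! h
      have h3 : f (T.symm g) = g := T.apply_symm_apply g
      exact hnot (T.symm g) (.inr (.inl ⟨h3, by rwa [h3]⟩))
    · rw [Fin.le_def, hT, hrank]
      exact finalPositions_le_boyRank hM c
  · push Not at hlt
    refine .inr ⟨hlt, ?_⟩
    obtain ⟨c, hc⟩ := hlt
    ext M
    simp only [Set.mem_empty_iff_false, iff_false]
    intro hM
    have := finalPositions_le_boyRank hM c
    have := (A.boyRank c (M c)).2
    omega

end StableMatching

/-! ### Expressions over the preference lists -/

namespace StableMatching

open RAM SMInstance Function

variable {n : ℕ}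

/-- The memory holds the preference lists, as in an input word. -/
def HoldsLists (A : SMInstance n) (m : ℕ → ℕ) : Prop :=
  (∀ b p : Fin n, m (5 + (n * b + p)) = A.boyList b p) ∧
    ∀ g p : Fin n, m (5 + (n * n + (n * g + p))) = A.girlList g p

theorem mul_add_lt (b p : Fin n) : n * b + p < n * n := by
  have h1 : n * (b + 1) ≤ n * n := Nat.mul_le_mul_left n b.2
  have h2 := p.2
  rw [Nat.mul_succ] at h1
  omega

theorem HoldsLists.congr {A : SMInstance n} {m m' : ℕ → ℕ} (h : HoldsLists A m)
    (hm : ∀ a, a < 5 + n * n + n * n → m' a = m a) : HoldsLists A m' := by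
  refine ⟨fun b p => ?_, fun g p => ?_⟩
  · rw [hm _ (by have := mul_add_lt b p; omega), h.1]
  · rw [hm _ (by have := mul_add_lt g p; omega), h.2]

theorem getD_ofFn_mul (f : Fin n → Fin n → ℕ) (w : List ℕ) (b p : Fin n) :
    (List.ofFn (fun k : Fin (n * n) => f k.divNat k.modNat) ++ w).getD (n * b + p) 0 = f b p := by
  have h := mul_add_lt b p
  rw [List.getD_eq_getElem _ _ (by simp; omega), List.getElem_append_left (by simpa using h),
    List.getElem_ofFn]
  congr 1
  · refine Fin.ext ?_
    simp only [Fin.divNat]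
    rw [Nat.mul_add_div (by have := p.2; omega), Nat.div_eq_of_lt p.2, add_zero]
  · refine Fin.ext ?_
    simp [Fin.modNat, Nat.mod_eq_of_lt p.2]

theorem holdsLists_init (A : SMInstance n) (s : Shift n) :
    HoldsLists A (State.init (encodeInput A s)).mem := by
  have h : ∃ x y z t, s.encode = [x, y, z, t] := by cases s <;> exact ⟨_, _, _, _, rfl⟩
  obtain ⟨x, y, z, t, h⟩ := h
  constructor
  · intro b p
    simp only [State.init, encodeInput, h, List.cons_append, List.nil_append]
    rw [show 5 + (n * b + p) = (n * b + p) + 1 + 1 + 1 + 1 + 1 by ring]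
    simp only [List.getD_cons_succ]
    exact getD_ofFn_mul (fun b p => (A.boyList b p : ℕ)) _ b p
  · intro g p
    simp only [State.init, encodeInput, h, List.cons_append, List.nil_append]
    rw [show 5 + (n * n + (n * g + p)) = (n * n + (n * g + p)) + 1 + 1 + 1 + 1 + 1 by ring]
    simp only [List.getD_cons_succ]
    rw [List.getD_append_right _ _ _ _ (by simp)]
    simp only [List.length_ofFn, Nat.add_sub_cancel_left]
    simpa using getD_ofFn_mul (fun b p => (A.girlList b p : ℕ)) [] g p

theorem init_mem_eq_zero (A : SMInstance n) (s : Shift n) {a : ℕ} (h : 5 + n * n + n * n ≤ a) :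
    (State.init (encodeInput A s)).mem a = 0 := by
  refine List.getD_eq_default _ _ ?_
  have : s.encode.length = 4 := by cases s <;> rfl
  simp [encodeInput, this]
  omega

/-- `n` times a variable -/
def mulSizeE (x : ℕ) : Expr := .sum 29 (.var x)

/-- `n * n` -/
def sqE : Expr := .sum 29 .size

/-- If `a = b` then `c` else `d`. -/
def ifEqE (a b c d : Expr) : Expr := .ite a b d (.ite b a d c)

/-- The girl in position `e` of the list of the boy in `x`. -/
def boyAtE (x : ℕ) (e : Expr) : Expr := .mem (.add (.const 5) (.add (mulSizeE x) e))

/-- The boy in position `e` of the list of the girl in `x`. -/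
def girlAtE (x : ℕ) (e : Expr) : Expr :=
  .mem (.add (.const 5) (.add sqE (.add (mulSizeE x) e)))

/-- The position of the girl in `y` on the list of the boy in `x`. -/
def boyRankE (x y : ℕ) : Expr :=
  .sum 28 (ifEqE (boyAtE x (.var 28)) (.var y) (.var 28) (.const 0))

/-- The position of the boy in `y` on the list of the girl in `x`. -/
def girlRankE (x y : ℕ) : Expr :=
  .sum 28 (ifEqE (girlAtE x (.var 28)) (.var y) (.var 28) (.const 0))

/-- The beginning of the work space with number `j`. -/
def areaE (j : ℕ) : Expr :=
  .add (.const 5) (.add sqE (.add sqE (Nat.rec (.const 0) (fun _ e => .add e .size) j)))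

/-- The position that the array at `B` holds for the boy in `x`. -/
def posE (B : Expr) (x : ℕ) : Expr := .mem (.add B (.var x))

/-- The girl in this position. -/
def partnerE (B : Expr) (x : ℕ) : Expr := boyAtE x (posE B x)

section Eval

variable {A : SMInstance n} {σ : State} {x y : ℕ}

theorem eval_sum (a : Expr) :
    (Expr.sum x a).eval n σ = ∑ i ∈ Finset.range n, a.eval n (σ.setReg x i) := rfl

theorem eval_ite (a b c d : Expr) : (Expr.ite a b c d).eval n σ =
    if a.eval n σ < b.eval n σ then c.eval n σ else d.eval n σ := rfl

@[simp] theorem eval_ifEqE (a b c d : Expr) : (ifEqE a b c d).eval n σ =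
    if a.eval n σ = b.eval n σ then c.eval n σ else d.eval n σ := by
  simp only [ifEqE, Expr.eval]
  split_ifs <;> first | rfl | omega

@[simp] theorem eval_mulSizeE (hx : x ≠ 29) : (mulSizeE x).eval n σ = n * σ.reg x := by
  simp [mulSizeE, Expr.eval, State.setReg_reg, hx]

@[simp] theorem eval_sqE : sqE.eval n σ = n * n := by
  simp [sqE, Expr.eval]

theorem eval_areaE (j : ℕ) : (areaE j).eval n σ = 5 + n * n + n * n + n * j := by
  have : ∀ j, (Nat.rec (.const 0) (fun _ e => .add e .size) j : Expr).eval n σ = n * j := by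
    intro j
    induction j with
    | zero => rfl
    | succ j ih => rw [Nat.mul_succ, ← ih]; rfl
  simp only [areaE, Expr.eval, eval_sqE, this]
  ring

theorem eval_boyAtE (h : HoldsLists A σ.mem) (hx : x ≠ 29) {b p : Fin n} {e : Expr}
    (hb : σ.reg x = b) (he : e.eval n σ = p) : (boyAtE x e).eval n σ = A.boyList b p := by
  simp only [boyAtE, Expr.eval, eval_mulSizeE hx, hb, he, h.1]

theorem eval_girlAtE (h : HoldsLists A σ.mem) (hx : x ≠ 29) {g p : Fin n} {e : Expr}
    (hg : σ.reg x = g) (he : e.eval n σ = p) : (girlAtE x e).eval n σ = A.girlList g p := by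
  simp only [girlAtE, Expr.eval, eval_mulSizeE hx, eval_sqE, hg, he, h.2]

theorem sum_ite_perm (L : Equiv.Perm (Fin n)) (c : Fin n) :
    (∑ i : Fin n, if (L i : ℕ) = c then (i : ℕ) else 0) = L.symm c := by
  rw [Finset.sum_eq_single (L.symm c)]
  · simp
  · intro i _ hi
    rw [if_neg]
    intro e
    exact hi ((Equiv.eq_symm_apply _).2 (Fin.ext e))
  · simp

theorem eval_boyRankE (h : HoldsLists A σ.mem) (hx : x < 28) (hy : y < 28) {b g : Fin n}
    (hb : σ.reg x = b) (hg : σ.reg y = g) : (boyRankE x y).eval n σ = A.boyRank b g := by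
  rw [boyRankE, Expr.eval, Finset.sum_range, boyRank, ← sum_ite_perm]
  refine Finset.sum_congr rfl fun i _ => ?_
  rw [eval_ifEqE, eval_boyAtE (A := A) (b := b) (p := i) (by exact h) (by omega)
    (by simp [State.setReg_reg, hb, hx.ne]) (by simp [State.setReg_reg, Expr.eval])]
  simp [Expr.eval, State.setReg_reg, hy.ne, hg]

theorem eval_girlRankE (h : HoldsLists A σ.mem) (hx : x < 28) (hy : y < 28) {g b : Fin n}
    (hg : σ.reg x = g) (hb : σ.reg y = b) : (girlRankE x y).eval n σ = A.girlRank g b := by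
  rw [girlRankE, Expr.eval, Finset.sum_range, girlRank, ← sum_ite_perm]
  refine Finset.sum_congr rfl fun i _ => ?_
  rw [eval_ifEqE, eval_girlAtE (A := A) (g := g) (p := i) (by exact h) (by omega)
    (by simp [State.setReg_reg, hg, hx.ne]) (by simp [State.setReg_reg, Expr.eval])]
  simp [Expr.eval, State.setReg_reg, hy.ne, hb]

/-- The memory holds the array `p` from address `β` on. -/
def HoldsArray (m : ℕ → ℕ) (β : ℕ) (p : Fin n → ℕ) : Prop := ∀ c : Fin n, m (β + c) = p c

theorem eval_posE {β : ℕ} {p : Fin n → ℕ} (h : HoldsArray σ.mem β p) {B : Expr}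
    (hB : ∀ σ, B.eval n σ = β) {c : Fin n} (hc : σ.reg x = c) : (posE B x).eval n σ = p c := by
  simp only [posE, Expr.eval, hB, hc]
  exact h c

theorem eval_partnerE {β : ℕ} {p : Fin n → ℕ} (h : HoldsLists A σ.mem)
    (hp : HoldsArray σ.mem β p) {B : Expr} (hB : ∀ σ, B.eval n σ = β) (hx : x ≠ 29) {c : Fin n}
    (hc : σ.reg x = c) (hlt : p c < n) :
    (partnerE B x).eval n σ = A.boyList c ⟨p c, hlt⟩ :=
  eval_boyAtE h hx hc (eval_posE hp hB hc)

end Eval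

section Run

variable {σ : State}

theorem run_seq (s t : Stmt) : (Stmt.seq s t).run n σ = t.run n (s.run n σ) := rfl

theorem run_assign (x : ℕ) (a : Expr) :
    (Stmt.assign x a).run n σ = σ.setReg x (a.eval n σ) := rfl

theorem run_store (a b : Expr) :
    (Stmt.store a b).run n σ = σ.setMem (a.eval n σ) (b.eval n σ) := rfl

theorem run_ite (a b : Expr) (s t : Stmt) : (Stmt.ite a b s t).run n σ =
    if a.eval n σ < b.eval n σ then s.run n σ else t.run n σ := rfl

end Run

/-- The effect of a loop is described by an invariant. -/
theorem run_loop {x : ℕ} {s : Stmt} {σ : State} (I : ℕ → State → Prop) (h0 : I 0 σ)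
    (hs : ∀ i < n, ∀ τ, I i τ → I (i + 1) (s.run n (τ.setReg x i))) :
    ∃ τ, I n τ ∧ (Stmt.loop x s).run n σ = τ.setReg x 0 := by
  refine ⟨_, ?_, rfl⟩
  have : ∀ i ≤ n, I i (Nat.rec σ (fun i τ => s.run n (τ.setReg x i)) i) := by
    intro i
    induction i with
    | zero => exact fun _ => h0
    | succ i ih => exact fun hi => hs i hi _ (ih (by omega))
  exact this n le_rfl

/-! ### The program for the best stable matching under lower bounds -/

/-- Positive if and only if the boy in `6` cannot stay with the girl in `9`. -/
def mustLeaveE (B : Expr) : Expr :=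
  .add (ifEqE (.var 6) (.var 0) (.ite (posE B 6) (.var 4) (.const 1) (.const 0)) (.const 0))
    (.add (ifEqE (.var 9) (.var 1) (.ite (girlRankE 9 6) (.var 5) (.const 0) (.const 1))
      (.const 0))
    (.sum 27 (.ite (posE B 27) (boyRankE 27 9) (.const 0)
      (.ite (girlRankE 9 27) (girlRankE 9 6) (.const 1) (.const 0)))))

/-- The boy in `6` moves on if he cannot stay. -/
def advanceS (B : Expr) : Stmt :=
  .ite (posE B 6) .size
    (.seq (.assign 9 (partnerE B 6))
      (.ite (.const 0) (mustLeaveE B)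
        (.store (.add B (.var 6)) (.add (posE B 6) (.const 1))) .skip)) .skip

/-- Compute the final positions in the array at `B`. -/
def finalPositionsS (B : Expr) : Stmt := .loop 7 (.loop 8 (.loop 6 (advanceS B)))

section FinalPositions

variable {A : SMInstance n} {σ τ : State} {b g : Fin n} {k l β : ℕ} {p : Fin n → ℕ} {B : Expr}

theorem eval_mustLeaveE_pos (h : HoldsLists A σ.mem) (hp : HoldsArray σ.mem β p)
    (hB : ∀ σ, B.eval n σ = β) {c d : Fin n} (hc : σ.reg 6 = c) (hd : σ.reg 9 = d)
    (h0 : σ.reg 0 = b) (h1 : σ.reg 1 = g) (h4 : σ.reg 4 = k) (h5 : σ.reg 5 = l) :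
    0 < (mustLeaveE B).eval n σ ↔ MustLeave A b k g l p c d := by
  have e : ∀ i : Fin n, ((Expr.ite (posE B 27) (boyRankE 27 9) (.const 0)
      (.ite (girlRankE 9 27) (girlRankE 9 6) (.const 1) (.const 0))).eval n (σ.setReg 27 i)) =
      if p i < A.boyRank i d then 0 else if A.girlRank d i < A.girlRank d c then 1 else 0 := by
    intro i
    have r9 : (σ.setReg 27 i).reg 9 = d := by simp [State.setReg_reg, hd]
    have r6 : (σ.setReg 27 i).reg 6 = c := by simp [State.setReg_reg, hc]
    have r27 : (σ.setReg 27 i).reg 27 = i := by simp [State.setReg_reg]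
    have h' : HoldsLists A (σ.setReg 27 i).mem := h
    simp only [Expr.eval, eval_posE (σ := σ.setReg 27 i) hp hB r27,
      eval_boyRankE h' (by omega) (by omega) r27 r9,
      eval_girlRankE h' (by omega) (by omega) r9 r27,
      eval_girlRankE h' (by omega) (by omega) r9 r6, Fin.lt_def]
  rw [mustLeaveE, Expr.eval, Expr.eval, eval_ifEqE, eval_ifEqE]
  rw [eval_sum, Finset.sum_range, Finset.sum_congr rfl fun i _ => e i]
  simp only [Expr.eval, eval_posE hp hB hc, eval_girlRankE h (by omega) (by omega) hd hc, hc, hd,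
    h0, h1, h4, h5]
  rw [MustLeave, Nat.add_pos_iff_pos_or_pos, Nat.add_pos_iff_pos_or_pos,
    Finset.sum_pos_iff]
  refine or_congr ?_ (or_congr ?_ (exists_congr fun i => ?_))
  · rw [Fin.ext_iff]
    split_ifs <;> simp [*]
  · rw [Fin.ext_iff]
    split_ifs <;> simp [*]
    omega
  · split_ifs <;> simp_all

/-- From the state `σ` to the state `τ`, only the registers `6, …, 9` and the array at `β` have
changed, which now holds `p`. -/
def ArrayStep (σ τ : State) (β : ℕ) (p : Fin n → ℕ) : Prop :=
  (∀ x, x < 6 ∨ 9 < x → τ.reg x = σ.reg x) ∧ HoldsArray τ.mem β p ∧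
    ∀ a, (∀ c : Fin n, a ≠ β + c) → τ.mem a = σ.mem a

theorem ArrayStep.setReg (h : ArrayStep σ τ β p) {x : ℕ} (hx : ¬ (x < 6 ∨ 9 < x)) (v : ℕ) :
    ArrayStep σ (τ.setReg x v) β p := by
  refine ⟨fun y hy => ?_, h.2.1, h.2.2⟩
  rw [State.setReg_reg, if_neg (by rintro rfl; exact hx hy), h.1 y hy]

theorem ArrayStep.holdsLists (h : ArrayStep σ τ β p) (hl : HoldsLists A σ.mem)
    (hβ : 5 + n * n + n * n ≤ β) : HoldsLists A τ.mem :=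
  hl.congr fun a ha => h.2.2 a fun c => by omega

theorem run_advanceS (hl : HoldsLists A σ.mem) (hβ : 5 + n * n + n * n ≤ β)
    (hB : ∀ σ, B.eval n σ = β) (h0 : σ.reg 0 = b) (h1 : σ.reg 1 = g) (h4 : σ.reg 4 = k)
    (h5 : σ.reg 5 = l) (h : ArrayStep σ τ β p) (c : Fin n) (hc : τ.reg 6 = c) :
    ArrayStep σ ((advanceS B).run n τ) β (advance A b k g l p c) := by
  have hl' := h.holdsLists hl hβ
  rw [advanceS, Stmt.run, eval_posE h.2.1 hB hc, Expr.eval, advance]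
  by_cases hlt : p c < n
  · rw [if_pos hlt, Stmt.run, Stmt.run, eval_partnerE hl' h.2.1 hB (by omega) hc hlt, Stmt.run]
    set τ' := τ.setReg 9 (A.boyList c ⟨p c, hlt⟩) with hτ'
    have h' : ArrayStep σ τ' β p := h.setReg (by omega) _
    have hc' : τ'.reg 6 = c := by simp [hτ', State.setReg_reg, hc]
    have hm : (Expr.const 0).eval n τ' < (mustLeaveE B).eval n τ' ↔ _ :=
      eval_mustLeaveE_pos (d := A.boyList c ⟨p c, hlt⟩) (h'.holdsLists hl hβ) h'.2.1 hB hc'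
        (by simp [hτ', State.setReg_reg]) ((h'.1 0 (by omega)).trans h0)
        ((h'.1 1 (by omega)).trans h1) ((h'.1 4 (by omega)).trans h4)
        ((h'.1 5 (by omega)).trans h5)
    by_cases hml : MustLeave A b k g l p c (A.boyList c ⟨p c, hlt⟩)
    · rw [if_pos (hm.2 hml), if_pos ⟨hlt, hml⟩]
      simp only [Stmt.run, Expr.eval, hB, eval_posE h'.2.1 hB hc', hc']
      refine ⟨h'.1, fun d => ?_, fun a ha => ?_⟩
      · rw [State.setMem_mem, update_apply, h'.2.1 d]
        simp only [Nat.add_left_cancel_iff, ← Fin.ext_iff]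
      · rw [State.setMem_mem, if_neg (ha c), h'.2.2 a ha]
    · rw [if_neg (fun h => hml (hm.1 h)), if_neg (fun h => hml h.2), Stmt.run]
      exact h'
  · rw [if_neg hlt, if_neg (fun h => hlt h.1), Stmt.run]
    exact h

theorem run_finalPositionsS (hl : HoldsLists A σ.mem) (hβ : 5 + n * n + n * n ≤ β)
    (hB : ∀ σ, B.eval n σ = β) (h0 : σ.reg 0 = b) (h1 : σ.reg 1 = g) (h4 : σ.reg 4 = k)
    (h5 : σ.reg 5 = l) (hz : ∀ c : Fin n, σ.mem (β + c) = 0) :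
    ArrayStep σ ((finalPositionsS B).run n σ) β (finalPositions A b k g l) := by
  have hsweep : ∀ τ p, ArrayStep σ τ β p →
      ArrayStep σ ((Stmt.loop 6 (advanceS B)).run n τ) β (sweep A b k g l p) := by
    intro τ p h
    obtain ⟨υ, hυ, e⟩ := run_loop (x := 6) (s := advanceS B)
      (fun i υ => ArrayStep σ υ β (sweepUpTo A b k g l p i)) h (fun i hi υ hυ => by
        rw [sweepUpTo, dif_pos hi]
        exact run_advanceS hl hβ hB h0 h1 h4 h5 (hυ.setReg (by omega) _) ⟨i, hi⟩
          (by simp [State.setReg_reg]))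
    rw [e]
    exact hυ.setReg (by omega) _
  have hsweeps : ∀ τ p, ArrayStep σ τ β p →
      ArrayStep σ ((Stmt.loop 8 (.loop 6 (advanceS B))).run n τ) β
        ((sweep A b k g l)^[n] p) := by
    intro τ p h
    obtain ⟨υ, hυ, e⟩ := run_loop (x := 8) (s := .loop 6 (advanceS B))
      (fun i υ => ArrayStep σ υ β ((sweep A b k g l)^[i] p)) h (fun i hi υ hυ => by
        rw [iterate_succ_apply']
        exact hsweep _ _ (hυ.setReg (by omega) _))
    rw [e]
    exact hυ.setReg (by omega) _
  obtain ⟨υ, hυ, e⟩ := run_loop (x := 7) (s := .loop 8 (.loop 6 (advanceS B)))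
    (fun i υ => ArrayStep σ υ β ((sweep A b k g l)^[n * i] 0)) ⟨fun _ _ => rfl, hz, fun _ _ => rfl⟩
    (fun i hi υ hυ => by
      rw [Nat.mul_succ, Nat.add_comm, iterate_add_apply]
      exact hsweeps _ _ (hυ.setReg (by omega) _))
  rw [finalPositionsS, e]
  exact hυ.setReg (by omega) _

end FinalPositions

/-! ### The program for dual orbits -/

/-- The first boy on the list of the girl in `10` who strictly prefers her to his partner. -/
def dualFirstE (B : Expr) : Expr :=
  .sum 20 (.ite (boyRankE 20 10) (posE B 20)
    (.ite (.sum 21 (.ite (boyRankE 21 10) (posE B 21)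
      (.ite (girlRankE 10 21) (girlRankE 10 20) (.const 1) (.const 0)) (.const 0))) (.const 1)
      (.var 20) (.const 0)) (.const 0))

/-- Write the pair that belongs to the girl in `10` as the pair with number `13` of the word that
begins at `14`, and move on to the next girl; `12` reports that this is the girl in `11`. -/
def dualStepS (B : Expr) : Stmt :=
  .ite (.var 12) (.const 1)
    (.seq (.assign 15 (dualFirstE B))
    (.seq (.store (.add (.var 14) (.add (.add (.var 13) (.var 13)) (.const 1))) (.var 15))
    (.seq (.store (.add (.var 14) (.add (.add (.var 13) (.var 13)) (.const 2))) (.var 10))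
    (.seq (.assign 13 (.add (.var 13) (.const 1)))
    (.seq (.assign 10 (partnerE B 15))
      (.assign 12 (ifEqE (.var 10) (.var 11) (.const 1) (.const 0))))))))
    .skip

/-- Write the dual orbit of the girl in `11` to the address in `14`, and add its length to `14`. -/
def dualOrbitS (B : Expr) : Stmt :=
  .seq (.assign 12 (.const 0)) (.seq (.assign 13 (.const 0)) (.seq (.assign 10 (.var 11))
    (.seq (.loop 16 (dualStepS B)) (.seq (.store (.var 14) (.var 13))
      (.assign 14 (.add (.var 14) (.add (.add (.var 13) (.var 13)) (.const 1))))))))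

section DualOrbit

variable {A : SMInstance n} {σ τ : State} {b g : Fin n} {k l β : ℕ} {T : Matching n} {B : Expr}

theorem eval_dualFirstE (h : HoldsLists A σ.mem)
    (hp : HoldsArray σ.mem β fun c => A.boyRank c (T c)) (hB : ∀ σ, B.eval n σ = β)
    (hg : σ.reg 10 = g) (hb : A.IsDualFirst T g b) : (dualFirstE B).eval n σ = b := by
  have e : ∀ c : Fin n, (Expr.sum 21 (.ite (boyRankE 21 10) (posE B 21)
      (.ite (girlRankE 10 21) (girlRankE 10 20) (.const 1) (.const 0)) (.const 0))).eval n
        (σ.setReg 20 c) = ∑ d : Fin n, if A.boyRank d g < A.boyRank d (T d) then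
          if A.girlRank g d < A.girlRank g c then 1 else 0 else 0 := by
    intro c
    rw [eval_sum, Finset.sum_range]
    refine Finset.sum_congr rfl fun d _ => ?_
    set τ := (σ.setReg 20 c).setReg 21 d with hτ
    have r10 : τ.reg 10 = g := by simp [hτ, State.setReg_reg, hg]
    have r20 : τ.reg 20 = c := by simp [hτ, State.setReg_reg]
    have r21 : τ.reg 21 = d := by simp [hτ, State.setReg_reg]
    have h' : HoldsLists A τ.mem := h
    simp only [Expr.eval, eval_posE (σ := τ) hp hB r21,
      eval_boyRankE h' (by omega) (by omega) r21 r10,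
      eval_girlRankE h' (by omega) (by omega) r10 r21,
      eval_girlRankE h' (by omega) (by omega) r10 r20, Fin.lt_def]
  rw [dualFirstE, eval_sum, Finset.sum_range]
  have e' : ∀ c : Fin n, (Expr.ite (boyRankE 20 10) (posE B 20)
      (.ite (.sum 21 (.ite (boyRankE 21 10) (posE B 21)
      (.ite (girlRankE 10 21) (girlRankE 10 20) (.const 1) (.const 0)) (.const 0))) (.const 1)
      (.var 20) (.const 0)) (.const 0)).eval n (σ.setReg 20 c) = if c = b then (b : ℕ) else 0 := by
    intro c
    have r10 : (σ.setReg 20 c).reg 10 = g := by simp [State.setReg_reg, hg]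
    have r20 : (σ.setReg 20 c).reg 20 = c := by simp [State.setReg_reg]
    have h' : HoldsLists A (σ.setReg 20 c).mem := h
    rw [eval_ite, eval_posE (σ := σ.setReg 20 c) hp hB r20,
      eval_boyRankE h' (by omega) (by omega) r20 r10, eval_ite, e c]
    simp only [Expr.eval, r20, Nat.lt_one_iff, ← Fin.lt_def]
    simp only [Finset.sum_eq_zero_iff]
    by_cases hc : c = b
    · subst hc
      rw [if_pos hb.1, if_pos, if_pos rfl]
      intro d _
      split_ifs with h1 h2
      · exact absurd h1 (hb.2 d h2)
      · rfl
      · rfl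
    · rw [if_neg hc]
      split_ifs with h1 h2
      · exfalso
        refine hc (IsDualFirst.unique (T := T) (g := g) ⟨h1, fun d hd hd' => ?_⟩ hb)
        simpa [hd, hd'] using h2 d (Finset.mem_univ d)
      · rfl
      · rfl
  rw [Finset.sum_congr rfl fun c _ => e' c]
  simp

/-- The memory holds the word `w` from address `o` on. -/
def HoldsWord (m : ℕ → ℕ) (o : ℕ) (w : List ℕ) : Prop :=
  ∀ (a : ℕ) (h : a < w.length), m (o + a) = w[a]

theorem holdsWord_cons {m : ℕ → ℕ} {o x : ℕ} {w : List ℕ} :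
    HoldsWord m o (x :: w) ↔ m o = x ∧ HoldsWord m (o + 1) w := by
  constructor
  · intro h
    refine ⟨h 0 (by simp), fun a ha => ?_⟩
    have := h (a + 1) (by simpa using ha)
    rw [List.getElem_cons_succ] at this
    rw [← this]
    congr 1
    ring
  · rintro ⟨h1, h2⟩ a ha
    cases a with
    | zero => exact h1
    | succ a =>
      have := h2 a (by simpa using ha)
      rw [List.getElem_cons_succ, ← this]
      congr 1
      ring

theorem holdsWord_append {m : ℕ → ℕ} {o : ℕ} {w w' : List ℕ} :
    HoldsWord m o (w ++ w') ↔ HoldsWord m o w ∧ HoldsWord m (o + w.length) w' := by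
  induction w generalizing o with
  | nil => simp [HoldsWord]
  | cons x w ih =>
    rw [List.cons_append, holdsWord_cons, holdsWord_cons, ih, and_assoc, List.length_cons,
      Nat.add_assoc, Nat.add_comm 1]

theorem holdsWord_flatMap {m : ℕ → ℕ} {o : ℕ} {ρ : List (Fin n × Fin n)}
    (h : ∀ (i : ℕ) (hi : i < ρ.length), m (o + 2 * i) = ρ[i].1 ∧ m (o + 2 * i + 1) = ρ[i].2) :
    HoldsWord m o (ρ.flatMap fun p => [(p.1 : ℕ), (p.2 : ℕ)]) := by
  induction ρ generalizing o with
  | nil => simp [HoldsWord]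
  | cons p ρ ih =>
    rw [List.flatMap_cons, List.cons_append, List.cons_append, List.nil_append, holdsWord_cons,
      holdsWord_cons]
    refine ⟨(h 0 (by simp)).1, (h 0 (by simp)).2, ih fun i hi => ?_⟩
    have := h (i + 1) (by simpa using hi)
    rw [List.getElem_cons_succ] at this
    rw [← this.1, ← this.2]
    constructor <;> congr 1 <;> ring

theorem boyList_boyRank (c h : Fin n) : A.boyList c (A.boyRank c h) = h :=
  (A.boyList c).apply_symm_apply h

/-- The first `j` pairs of the dual orbit of `g` have been written after address `o`. -/
def OrbitStep (A : SMInstance n) (T : Matching n) (g : Fin n) (o j : ℕ) (σ τ : State) : Prop :=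
  (∀ x < 10, τ.reg x = σ.reg x) ∧ (∀ a ≤ o, τ.mem a = σ.mem a) ∧
  (∀ t < j, τ.mem (o + (t + t + 1)) = dualFirst A T ((dualNext A T)^[t] g) ∧
    τ.mem (o + (t + t + 2)) = ((dualNext A T)^[t] g : Fin n)) ∧
  τ.reg 10 = ((dualNext A T)^[j] g : Fin n) ∧ τ.reg 11 = g ∧
  τ.reg 12 = (if j = minimalPeriod (dualNext A T) g then 1 else 0) ∧ τ.reg 13 = j ∧ τ.reg 14 = o

theorem OrbitStep.setReg {o j : ℕ} (h : OrbitStep A T g o j σ τ) {x : ℕ} (hx : 15 ≤ x) (v : ℕ) :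
    OrbitStep A T g o j σ (τ.setReg x v) := by
  have e : ∀ y < 15, (τ.setReg x v).reg y = τ.reg y := fun y hy => by
    rw [State.setReg_reg, if_neg (by omega)]
  obtain ⟨h1, h2, h3, h4, h5, h6, h7, h8⟩ := h
  refine ⟨fun y hy => (e y (by omega)).trans (h1 y hy), h2, h3, ?_, ?_, ?_, ?_, ?_⟩ <;>
    rw [e _ (by omega)] <;> assumption

theorem run_dualStepS (hl : HoldsLists A σ.mem) (hβ : 5 + n * n + n * n ≤ β)
    (hp : HoldsArray σ.mem β fun c => A.boyRank c (T c)) (hB : ∀ σ, B.eval n σ = β)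
    {o : ℕ} (ho : β + n ≤ o) (hc : A.IsDualCycle T (dualOrbit A T g)) {i : ℕ}
    (h : OrbitStep A T g o (min i (minimalPeriod (dualNext A T) g)) σ τ) :
    OrbitStep A T g o (min (i + 1) (minimalPeriod (dualNext A T) g)) σ
      ((dualStepS B).run n τ) := by
  set r := minimalPeriod (dualNext A T) g with hr
  obtain ⟨h1, h2, h3, h4, h5, h6, h7, h8⟩ := h
  by_cases hir : r ≤ i
  · rw [min_eq_right hir] at *
    rw [min_eq_right (by omega)]
    rw [if_pos rfl] at h6
    have e : (dualStepS B).run n τ = τ := by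
      rw [dualStepS, Stmt.run, if_neg (by simp [Expr.eval, h6]), Stmt.run]
    rw [e]
    exact ⟨h1, h2, h3, h4, h5, by rw [h6, if_pos rfl], h7, h8⟩
  have hlt : i < r := not_le.1 hir
  rw [min_eq_left hlt.le] at *
  rw [min_eq_left hlt]
  rw [if_neg hlt.ne] at h6
  have hdf := (hc.2.2 i (by simpa [dualOrbit] using hlt)).1
  simp only [dualOrbit, List.getElem_map, List.getElem_range] at hdf
  set cur := (dualNext A T)^[i] g with hcur
  set b := dualFirst A T cur with hb
  have hnext : (dualNext A T)^[i + 1] g = T b := by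
    rw [iterate_succ_apply', dualNext]
  have hlists : ∀ m : ℕ → ℕ, (∀ a < o, m a = σ.mem a) → HoldsLists A m := fun m hm =>
    hl.congr fun a ha => hm a (by omega)
  have harr : ∀ m : ℕ → ℕ, (∀ a < o, m a = σ.mem a) →
      HoldsArray m β fun c => (A.boyRank c (T c) : ℕ) := fun m hm c => by
    rw [hm _ (by have := c.2; omega), hp c]
  have e1 : (dualFirstE B).eval n τ = b :=
    eval_dualFirstE (hlists _ fun a ha => h2 a ha.le) (harr _ fun a ha => h2 a ha.le) hB h4 hdf
  let τ4 := (((τ.setReg 15 b).setMem (o + (i + i + 1)) b).setMem (o + (i + i + 2)) cur).setReg 13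
    (i + 1)
  have hmem4 : ∀ a ≤ o, τ4.mem a = σ.mem a := fun a ha => by
    simp only [τ4, State.setReg_mem, State.setMem_mem]
    rw [if_neg (by omega), if_neg (by omega), h2 a ha]
  have e2 : (partnerE B 15).eval n τ4 = T b := by
    rw [eval_partnerE (p := fun c => (A.boyRank c (T c) : ℕ)) (hlists _ fun a ha => hmem4 a ha.le)
      (harr _ fun a ha => hmem4 a ha.le) hB (by omega) (c := b)
      (by simp [τ4, State.setReg_reg]) (Fin.is_lt _)]
    exact congrArg _ (boyList_boyRank b (T b))
  have e3 : (dualStepS B).run n τ = (τ4.setReg 10 (T b)).setReg 12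
      (if T b = g then 1 else 0) := by
    simp only [dualStepS, Stmt.run, Expr.eval, e1, h6, Nat.zero_lt_one, if_true]
    have e4 : ((((τ.setReg 15 b).setMem ((τ.setReg 15 b).reg 14 + ((τ.setReg 15 b).reg 13 +
        (τ.setReg 15 b).reg 13 + 1)) ((τ.setReg 15 b).reg 15)).setMem
        ((τ.setReg 15 b).reg 14 + ((τ.setReg 15 b).reg 13 + (τ.setReg 15 b).reg 13 + 2))
        ((τ.setReg 15 b).reg 10)).setReg 13 ((τ.setReg 15 b).reg 13 + 1)) = τ4 := by
      simp [τ4, State.setReg_reg, h7, h8, h4]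
    simp only [State.setMem_reg] at e4 ⊢
    rw [e4, e2, eval_ifEqE]
    simp [Expr.eval, State.setReg_reg, τ4, h5, Fin.ext_iff]
  rw [e3]
  refine ⟨fun x hx => ?_, hmem4, fun t ht => ?_, ?_, ?_, ?_, ?_, ?_⟩
  · simp only [State.setReg_reg, τ4, State.setMem_reg]
    repeat rw [if_neg (by omega)]
    exact h1 x hx
  · simp only [State.setReg_mem, τ4, State.setMem_mem]
    rcases Nat.lt_succ_iff_lt_or_eq.1 ht with ht | rfl
    · repeat rw [if_neg (by omega)]
      exact h3 t ht
    · rw [if_neg (by omega), if_pos rfl, if_pos rfl]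
      exact ⟨rfl, rfl⟩
  · simp [State.setReg_reg, hnext]
  · simp [State.setReg_reg, τ4, h5]
  · have : T b = g ↔ i + 1 = r := by
      rw [← hnext]
      constructor
      · intro e
        by_contra hne
        exact not_isPeriodicPt_of_pos_of_lt_minimalPeriod (Nat.succ_ne_zero i)
          (by omega) e
      · intro e
        rw [e]
        exact iterate_minimalPeriod
    simp [State.setReg_reg, this, hr]
  · simp [State.setReg_reg, τ4]
  · simp [State.setReg_reg, τ4, h8]

theorem length_dualOrbit_le (hc : A.IsDualCycle T (dualOrbit A T g)) :
    (dualOrbit A T g).length ≤ n := by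
  simpa using hc.nodup_boys.length_le_card

theorem run_dualOrbitS (hl : HoldsLists A σ.mem) (hβ : 5 + n * n + n * n ≤ β)
    (hp : HoldsArray σ.mem β fun c => A.boyRank c (T c)) (hB : ∀ σ, B.eval n σ = β)
    {o : ℕ} (ho : β + n ≤ o) (hc : A.IsDualCycle T (dualOrbit A T g)) (hg : σ.reg 11 = g)
    (h14 : σ.reg 14 = o) :
    (∀ x < 10, ((dualOrbitS B).run n σ).reg x = σ.reg x) ∧
    (∀ a < o, ((dualOrbitS B).run n σ).mem a = σ.mem a) ∧
    HoldsWord ((dualOrbitS B).run n σ).mem o (encodeRotation (some (dualOrbit A T g))) ∧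
    ((dualOrbitS B).run n σ).reg 14 =
      o + (encodeRotation (some (dualOrbit A T g))).length := by
  have hlen : (dualOrbit A T g).length = minimalPeriod (dualNext A T) g := by simp [dualOrbit]
  have hpos : 0 < minimalPeriod (dualNext A T) g := hlen ▸ List.length_pos_iff.2 hc.1
  have hle : minimalPeriod (dualNext A T) g ≤ n := hlen ▸ length_dualOrbit_le hc
  obtain ⟨υ, hυ, e⟩ := run_loop (n := n) (x := 16) (s := dualStepS B)
    (σ := ((σ.setReg 12 0).setReg 13 0).setReg 10 g)
    (fun i υ => OrbitStep A T g o (min i (minimalPeriod (dualNext A T) g)) σ υ)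
    (by
      refine ⟨fun x hx => ?_, fun a _ => rfl, fun t ht => ?_, ?_, ?_, ?_, ?_, ?_⟩
      · simp only [State.setReg_reg]
        repeat rw [if_neg (by omega)]
      · simp at ht
      · simp [State.setReg_reg]
      · simp [State.setReg_reg, hg]
      · rw [Nat.zero_min, if_neg hpos.ne]
        simp [State.setReg_reg]
      · simp [State.setReg_reg]
      · simp [State.setReg_reg, h14])
    (fun i hi υ hυ => run_dualStepS hl hβ hp hB ho hc (hυ.setReg (by omega) _))
  rw [min_eq_right hle] at hυ
  obtain ⟨h1, h2, h3, h4, h5, h6, h7, h8⟩ := hυ.setReg (x := 16) (by omega) 0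
  have e' : (dualOrbitS B).run n σ = ((υ.setReg 16 0).setMem o
      (minimalPeriod (dualNext A T) g)).setReg 14
        (o + (minimalPeriod (dualNext A T) g + minimalPeriod (dualNext A T) g + 1)) := by
    simp only [dualOrbitS, run_seq, run_assign, run_store, Expr.eval]
    rw [show ((σ.setReg 12 0).setReg 13 0).setReg 10 (((σ.setReg 12 0).setReg 13 0).reg 11) =
      ((σ.setReg 12 0).setReg 13 0).setReg 10 g by simp [State.setReg_reg, hg], e]
    simp only [State.setMem_reg, h7, h8]
  rw [e']
  refine ⟨fun x hx => ?_, fun a ha => ?_, ?_, ?_⟩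
  · rw [State.setReg_reg, if_neg (by omega), State.setMem_reg, h1 x hx]
  · rw [State.setReg_mem, State.setMem_mem, if_neg (by omega), h2 a ha.le]
  · rw [encodeRotation, holdsWord_cons, hlen]
    refine ⟨by simp [State.setMem_mem], holdsWord_flatMap fun i hi => ?_⟩
    rw [hlen] at hi
    have := h3 i hi
    simp only [State.setReg_mem, State.setMem_mem] at this ⊢
    rw [if_neg (by omega), if_neg (by omega), show o + 1 + 2 * i = o + (i + i + 1) by ring,
      show o + (i + i + 1) + 1 = o + (i + i + 2) by ring]
    simpa [dualOrbit] using this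
  · have : ∀ ρ : List (Fin n × Fin n), (encodeRotation (some ρ)).length =
        ρ.length + ρ.length + 1 := fun ρ => by
      simp [encodeRotation, List.length_flatMap, mul_two]
    rw [this, hlen]
    simp [State.setReg_reg]

end DualOrbit

end StableMatching

/-! ### The algorithm -/

namespace StableMatching

open RAM SMInstance Function

variable {n : ℕ} {A : SMInstance n} {σ τ : State} {b g : Fin n} {k l : ℕ}

/-- Compute the parameters of the window in the registers `0, …, 3`. -/
def paramsS : Stmt :=
  .ite (.mem (.const 1)) (.const 1)
    (.seq (.assign 1 (.mem (.const 2)))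
    (.seq (.assign 0 (girlAtE 1 (.mem (.const 4))))
    (.seq (.assign 2 (.add (boyRankE 0 1) (.const 1)))
      (.assign 3 (.mem (.const 3))))))
    (.seq (.assign 0 (.mem (.const 2)))
    (.seq (.assign 1 (boyAtE 0 (.mem (.const 4))))
    (.seq (.assign 2 (.mem (.const 3)))
      (.assign 3 (.add (girlRankE 1 0) (.const 1))))))

/-- The registers `0, …, 3` hold the parameters of a window. -/
def HoldsParams (σ : State) (b : Fin n) (k : ℕ) (g : Fin n) (l : ℕ) : Prop :=
  σ.reg 0 = b ∧ σ.reg 1 = g ∧ σ.reg 2 = k ∧ σ.reg 3 = l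

theorem HoldsParams.congr (h : HoldsParams σ b k g l) (hr : ∀ x < 4, τ.reg x = σ.reg x) :
    HoldsParams τ b k g l :=
  ⟨(hr 0 (by omega)).trans h.1, (hr 1 (by omega)).trans h.2.1, (hr 2 (by omega)).trans h.2.2.1,
    (hr 3 (by omega)).trans h.2.2.2⟩

theorem run_paramsS (A : SMInstance n) (s : Shift n) : ∃ (b : Fin n) (k : ℕ) (g : Fin n) (l : ℕ),
    lostMatchings A (A.applyShift s) = window A b k g l ∧
    HoldsParams (paramsS.run n (State.init (encodeInput A s))) b k g l ∧
    (paramsS.run n (State.init (encodeInput A s))).mem =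
      (State.init (encodeInput A s)).mem := by
  have hl := holdsLists_init A s
  cases s with
  | girl g i j h =>
    refine ⟨_, _, _, _, lostMatchings_girl g h, ?_⟩
    set σ := State.init (encodeInput A (.girl g i j h)) with hσ
    have m1 : σ.mem 1 = 0 := rfl
    have m2 : σ.mem 2 = g := rfl
    have m3 : σ.mem 3 = i := rfl
    have m4 : σ.mem 4 = j := rfl
    have e1 : (girlAtE 1 (.mem (.const 4))).eval n (σ.setReg 1 g) = A.girlList g j :=
      eval_girlAtE (by exact hl) (by omega) (by simp [State.setReg_reg]) m4
    have e2 : (boyRankE 0 1).eval n ((σ.setReg 1 g).setReg 0 (A.girlList g j)) =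
        A.boyRank (A.girlList g j) g :=
      eval_boyRankE (by exact hl) (by omega) (by omega) (by simp [State.setReg_reg])
        (by simp [State.setReg_reg])
    simp only [paramsS, run_ite, run_seq, run_assign, Expr.eval, m1, m2, Nat.zero_lt_one, if_true,
      e1, e2, State.setReg_mem, m3, and_true]
    simp [HoldsParams, State.setReg_reg]
  | boy b i j h =>
    refine ⟨_, _, _, _, lostMatchings_boy b h, ?_⟩
    set σ := State.init (encodeInput A (.boy b i j h)) with hσ
    have m1 : σ.mem 1 = 1 := rfl
    have m2 : σ.mem 2 = b := rfl
    have m3 : σ.mem 3 = i := rfl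
    have m4 : σ.mem 4 = j := rfl
    have e1 : (boyAtE 0 (.mem (.const 4))).eval n (σ.setReg 0 b) = A.boyList b j :=
      eval_boyAtE (by exact hl) (by omega) (by simp [State.setReg_reg]) m4
    have e2 : (girlRankE 1 0).eval n (((σ.setReg 0 b).setReg 1 (A.boyList b j)).setReg 2 i) =
        A.girlRank (A.boyList b j) b :=
      eval_girlRankE (by exact hl) (by omega) (by omega) (by simp [State.setReg_reg])
        (by simp [State.setReg_reg])
    simp only [paramsS, run_ite, run_seq, run_assign, Expr.eval, m1, m2, lt_irrefl, if_false,
      e1, e2, State.setReg_mem, m3, and_true]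
    simp [HoldsParams, State.setReg_reg]

/-- Compute the best stable matchings for three pairs of bounds. -/
def arraysS : Stmt :=
  .seq (.assign 4 (.const 0)) (.seq (.assign 5 .size) (.seq (finalPositionsS (areaE 0))
    (.seq (.assign 4 (.var 2)) (.seq (finalPositionsS (areaE 1))
      (.seq (.assign 5 (.var 3)) (finalPositionsS (areaE 2)))))))

/-- The address of the work space with number `j`. -/
def area (n j : ℕ) : ℕ := 5 + n * n + n * n + n * j

theorem area_succ (n j : ℕ) : area n (j + 1) = area n j + n := by
  rw [area, area, Nat.mul_succ]
  ring

theorem le_area (n j : ℕ) : 5 + n * n + n * n ≤ area n j := Nat.le_add_right _ _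

/-- The memory holds the preference lists and the three arrays. -/
def HoldsData (A : SMInstance n) (b : Fin n) (k : ℕ) (g : Fin n) (l : ℕ) (m : ℕ → ℕ) : Prop :=
  HoldsLists A m ∧ HoldsArray m (area n 0) (finalPositions A b 0 g n) ∧
    HoldsArray m (area n 1) (finalPositions A b k g n) ∧
    HoldsArray m (area n 2) (finalPositions A b k g l)

theorem HoldsData.congr {m m' : ℕ → ℕ} (h : HoldsData A b k g l m)
    (hm : ∀ a < area n 3, m' a = m a) : HoldsData A b k g l m' := by
  have h1 : area n 1 = area n 0 + n := area_succ n 0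
  have h2 : area n 2 = area n 1 + n := area_succ n 1
  have h3 : area n 3 = area n 2 + n := area_succ n 2
  have h0 := le_area n 0
  refine ⟨h.1.congr fun a ha => hm a (by omega), fun c => ?_, fun c => ?_, fun c => ?_⟩
  · rw [hm _ (by have := c.2; omega), h.2.1 c]
  · rw [hm _ (by have := c.2; omega), h.2.2.1 c]
  · rw [hm _ (by have := c.2; omega), h.2.2.2 c]

theorem run_arraysS (hl : HoldsLists A σ.mem) (h : HoldsParams σ b k g l)
    (hz : ∀ a, area n 0 ≤ a → σ.mem a = 0) :
    HoldsParams (arraysS.run n σ) b k g l ∧ HoldsData A b k g l (arraysS.run n σ).mem := by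
  have hB : ∀ j σ, (areaE j).eval n σ = area n j := fun j σ => eval_areaE j
  have h1 : area n 1 = area n 0 + n := area_succ n 0
  have h2 : area n 2 = area n 1 + n := area_succ n 1
  have hle := le_area n
  simp only [arraysS, run_seq, run_assign]
  set σ1 := (σ.setReg 4 ((Expr.const 0).eval n σ)).setReg 5
    (Expr.size.eval n (σ.setReg 4 ((Expr.const 0).eval n σ))) with hσ1
  have hp1 : HoldsParams σ1 b k g l := h.congr fun x hx => by
    simp only [hσ1, State.setReg_reg]
    repeat rw [if_neg (by omega)]
  have s1 := run_finalPositionsS (A := A) (k := 0) (l := n) (β := area n 0) (B := areaE 0)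
    (σ := σ1) hl (hle 0) (hB 0) hp1.1 hp1.2.1 (by simp [hσ1, State.setReg_reg, Expr.eval])
    (by simp [hσ1, State.setReg_reg, Expr.eval]) (fun c => hz _ (by omega))
  set τ1 := (finalPositionsS (areaE 0)).run n σ1 with hτ1
  have hq1 : HoldsParams τ1 b k g l := hp1.congr fun x hx => s1.1 x (by omega)
  have hl1 : HoldsLists A τ1.mem := s1.holdsLists hl (hle 0)
  set σ2 := τ1.setReg 4 ((Expr.var 2).eval n τ1) with hσ2
  have hp2 : HoldsParams σ2 b k g l := hq1.congr fun x hx => by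
    rw [hσ2, State.setReg_reg, if_neg (by omega)]
  have s2 := run_finalPositionsS (A := A) (k := k) (l := n) (β := area n 1) (B := areaE 1)
    (σ := σ2) hl1 (hle 1) (hB 1) hp2.1 hp2.2.1
    (by simp [hσ2, State.setReg_reg, Expr.eval, hq1.2.2.1])
    (by
      rw [hσ2, State.setReg_reg, if_neg (by omega), s1.1 5 (by omega)]
      simp [hσ1, State.setReg_reg, Expr.eval])
    (fun c => (s1.2.2 _ fun d => by have := d.2; omega).trans (hz _ (by omega)))
  set τ2 := (finalPositionsS (areaE 1)).run n σ2 with hτ2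
  have hq2 : HoldsParams τ2 b k g l := hp2.congr fun x hx => s2.1 x (by omega)
  have hl2 : HoldsLists A τ2.mem := s2.holdsLists hl1 (hle 1)
  set σ3 := τ2.setReg 5 ((Expr.var 3).eval n τ2) with hσ3
  have hp3 : HoldsParams σ3 b k g l := hq2.congr fun x hx => by
    rw [hσ3, State.setReg_reg, if_neg (by omega)]
  have s3 := run_finalPositionsS (A := A) (k := k) (l := l) (β := area n 2) (B := areaE 2)
    (σ := σ3) hl2 (hle 2) (hB 2) hp3.1 hp3.2.1
    (by
      rw [hσ3, State.setReg_reg, if_neg (by omega), s2.1 4 (by omega)]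
      simp [hσ2, State.setReg_reg, Expr.eval, hq1.2.2.1])
    (by simp [hσ3, State.setReg_reg, Expr.eval, hq2.2.2.2])
    (fun c => ((s2.2.2 _ fun d => by have := d.2; omega).trans
      (s1.2.2 _ fun d => by have := d.2; omega)).trans (hz _ (by omega)))
  refine ⟨hp3.congr fun x hx => s3.1 x (by omega), s3.holdsLists hl2 (hle 2), fun c => ?_,
    fun c => ?_, s3.2.1⟩
  · rw [s3.2.2 _ fun d => by have := c.2; omega]
    exact (s2.2.2 _ fun d => by have := c.2; omega).trans (s1.2.1 c)
  · rw [s3.2.2 _ fun d => by have := c.2; omega]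
    exact s2.2.1 c

/-- Positive if and only if some boy has come to the end of his list. -/
def failE (B : Expr) : Expr := .sum 27 (.ite (posE B 27) .size (.const 0) (.const 1))

/-- Positive if and only if the partner of the girl in `1` has a position before `3`. -/
def girlBeforeE (B : Expr) : Expr :=
  .sum 27 (ifEqE (partnerE B 27) (.var 1)
    (.ite (girlRankE 1 27) (.var 3) (.const 1) (.const 0)) (.const 0))

theorem eval_failE_pos {β : ℕ} {p : Fin n → ℕ} {B : Expr} (hp : HoldsArray σ.mem β p)
    (hB : ∀ σ, B.eval n σ = β) : 0 < (failE B).eval n σ ↔ ∃ c, n ≤ p c := by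
  have e : ∀ c : Fin n, (Expr.ite (posE B 27) .size (.const 0) (.const 1)).eval n
      (σ.setReg 27 c) = if p c < n then 0 else 1 := fun c => by
    rw [eval_ite, eval_posE (σ := σ.setReg 27 c) (c := c) hp hB (by simp [State.setReg_reg])]
    rfl
  rw [failE, eval_sum, Finset.sum_range, Finset.sum_congr rfl fun c _ => e c, Finset.sum_pos_iff]
  refine exists_congr fun c => ?_
  split_ifs with h <;> simp <;> omega

theorem eval_girlBeforeE_pos {β : ℕ} {T : Matching n} {B : Expr} (hl : HoldsLists A σ.mem)
    (hp : HoldsArray σ.mem β fun c => A.boyRank c (T c)) (hB : ∀ σ, B.eval n σ = β)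
    (h1 : σ.reg 1 = g) (h3 : σ.reg 3 = l) :
    0 < (girlBeforeE B).eval n σ ↔ (A.girlRank g (T.symm g) : ℕ) < l := by
  have e : ∀ c : Fin n, (ifEqE (partnerE B 27) (.var 1)
      (.ite (girlRankE 1 27) (.var 3) (.const 1) (.const 0)) (.const 0)).eval n
      (σ.setReg 27 c) = if c = T.symm g then if (A.girlRank g (T.symm g) : ℕ) < l then 1 else 0
        else 0 := fun c => by
    have r27 : (σ.setReg 27 c).reg 27 = c := by simp [State.setReg_reg]
    have r1 : (σ.setReg 27 c).reg 1 = g := by simp [State.setReg_reg, h1]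
    have r3 : (σ.setReg 27 c).reg 3 = l := by simp [State.setReg_reg, h3]
    have hl' : HoldsLists A (σ.setReg 27 c).mem := hl
    rw [eval_ifEqE, eval_ite, eval_girlRankE hl' (by omega) (by omega) r1 r27,
      eval_partnerE (p := fun c => (A.boyRank c (T c) : ℕ)) hl' hp hB (by omega) r27
        (Fin.is_lt _)]
    simp only [Expr.eval, r1, r3, Fin.eta, boyList_boyRank, Fin.val_inj]
    by_cases hc : c = T.symm g
    · subst hc
      simp
    · rw [if_neg hc, if_neg]
      exact fun e => hc ((Equiv.eq_symm_apply _).2 e)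
  rw [girlBeforeE, eval_sum, Finset.sum_range, Finset.sum_congr rfl fun c _ => e c,
    Finset.sum_ite_eq' Finset.univ, if_pos (Finset.mem_univ _)]
  split_ifs with h <;> simp [h]

theorem encodeRotation_none :
    encodeRotation (none : Option (List (Fin n × Fin n))) = [0] := rfl

/-- Write the word for the absence of a rotation. -/
def noneS : Stmt :=
  .seq (.store (.var 14) (.const 0)) (.assign 14 (.add (.var 14) (.const 1)))

/-- From the state `σ` to the state `τ` the word for `ρ` has been written to the address in
`14`, and its length has been added to `14`. -/
def Writes (σ τ : State) (ρ : Option (List (Fin n × Fin n))) : Prop :=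
  (∀ x < 10, τ.reg x = σ.reg x) ∧ (∀ a < σ.reg 14, τ.mem a = σ.mem a) ∧
    HoldsWord τ.mem (σ.reg 14) (encodeRotation ρ) ∧
    τ.reg 14 = σ.reg 14 + (encodeRotation ρ).length ∧ (encodeRotation ρ).length ≤ 2 * n + 1

theorem writes_noneS : Writes (n := n) σ (noneS.run n σ) none := by
  simp only [noneS, run_seq, run_store, run_assign, Expr.eval]
  rw [Writes, encodeRotation_none]
  refine ⟨fun x hx => ?_, fun a ha => ?_, ?_, ?_, by simp⟩
  · rw [State.setReg_reg, if_neg (by omega), State.setMem_reg]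
  · rw [State.setReg_mem, State.setMem_mem, if_neg (by omega)]
  · rw [holdsWord_cons]
    exact ⟨by simp [State.setMem_mem], fun a ha => by simp at ha⟩
  · simp [State.setReg_reg]

theorem writes_dualOrbitS {j : ℕ} {T : Matching n} {e : Expr} (hl : HoldsLists A σ.mem)
    (hp : HoldsArray σ.mem (area n j) fun c => A.boyRank c (T c))
    (ho : area n j + n ≤ σ.reg 14) (hc : A.IsDualCycle T (dualOrbit A T g))
    (he : e.eval n σ = g) :
    Writes σ ((Stmt.seq (.assign 11 e) (dualOrbitS (areaE j))).run n σ)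
      (some (dualOrbit A T g)) := by
  rw [run_seq, run_assign, he]
  obtain ⟨h1, h2, h3, h4⟩ := run_dualOrbitS (σ := σ.setReg 11 g) (B := areaE j) hl (le_area n j)
    hp (fun _ => eval_areaE j) ho hc (by simp [State.setReg_reg]) (by simp [State.setReg_reg])
  refine ⟨fun x hx => ?_, h2, h3, h4, ?_⟩
  · rw [h1 x hx, State.setReg_reg, if_neg (by omega)]
  · have := length_dualOrbit_le hc
    simp only [encodeRotation, List.length_cons, List.length_flatMap, List.length_nil,
      List.map_const', List.sum_replicate, smul_eq_mul]
    omega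

/-- Write the words for the two rotations. -/
def rotationsS : Stmt :=
  .seq (.assign 14 (areaE 3))
    (.ite (.const 0) (.add (failE (areaE 1)) (girlBeforeE (areaE 1))) (.seq noneS noneS)
      (.seq
        (.ite (posE (areaE 0) 0) (.var 2)
          (.seq (.assign 11 (partnerE (areaE 1) 0)) (dualOrbitS (areaE 1))) noneS)
        (.ite (.const 0) (failE (areaE 2)) noneS
          (.seq (.assign 11 (.var 1)) (dualOrbitS (areaE 2))))))

theorem constrained_size : constrained A b k g n =
    {M | M ∈ A.stableMatchings ∧ k ≤ (A.boyRank b (M b) : ℕ)} := by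
  ext M
  simp [constrained]

theorem run_rotationsS (h : HoldsParams σ b k g l) (hd : HoldsData A b k g l σ.mem) :
    ∃ ρin ρout : Option (List (Fin n × Fin n)),
      IsTheRotationOf (rotationsInto A (window A b k g l)) ρin ∧
      IsTheRotationOf (rotationsOutOf A (window A b k g l)) ρout ∧
      HoldsWord (rotationsS.run n σ).mem (area n 3) (encodeRotation ρin ++ encodeRotation ρout) ∧
      (encodeRotation ρin ++ encodeRotation ρout).length ≤ 4 * n + 2 := by
  have h1 : area n 1 = area n 0 + n := area_succ n 0
  have h2 : area n 2 = area n 1 + n := area_succ n 1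
  have h3 : area n 3 = area n 2 + n := area_succ n 2
  have hB : ∀ j σ, (areaE j).eval n σ = area n j := fun j σ => eval_areaE j
  rw [rotationsS, run_seq, run_assign, hB]
  set σ' := σ.setReg 14 (area n 3) with hσ'
  have h14 : σ'.reg 14 = area n 3 := by simp [hσ', State.setReg_reg]
  have hp : HoldsParams σ' b k g l := h.congr fun x hx => by
    rw [hσ', State.setReg_reg, if_neg (by omega)]
  have hd' : HoldsData A b k g l σ'.mem := hd
  -- two parts one after the other
  have comb : ∀ (τ υ : State) (ρ ρ' : Option (List (Fin n × Fin n))), Writes σ' τ ρ →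
      Writes τ υ ρ' → HoldsWord υ.mem (area n 3) (encodeRotation ρ ++ encodeRotation ρ') ∧
      (encodeRotation ρ ++ encodeRotation ρ').length ≤ 4 * n + 2 := by
    rintro τ υ ρ ρ' ⟨-, -, w1, w2, w3⟩ ⟨-, v1, v2, -, v3⟩
    refine ⟨holdsWord_append.2 ⟨fun a ha => ?_, ?_⟩, ?_⟩
    · rw [v1 _ (by omega), ← h14]
      exact w1 a ha
    · rwa [w2, h14] at v2
    · rw [List.length_append]
      omega
  have hfail : 0 < (failE (areaE 1)).eval n σ' ↔ _ := eval_failE_pos hd'.2.2.1 (hB 1)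
  rw [run_ite, Expr.eval, Expr.eval]
  rcases finalPositions_spec (A := A) (b := b) (k := k) (g := g) (l := n) with
    ⟨hlt, T, hT, hTp⟩ | ⟨hge, hempty⟩
  swap
  · rw [if_pos (Nat.add_pos_left (hfail.2 hge) _), run_seq]
    have hw : window A b k g l = ∅ := Set.subset_eq_empty (fun M hM => by
      rw [constrained_size]
      exact ⟨hM.1, hM.2.1⟩) hempty
    have hnone := isTheRotationOf_none_of_eq_empty hw
    exact ⟨none, none, hnone.1, hnone.2, comb _ _ _ _ writes_noneS writes_noneS⟩
  rw [constrained_size] at hT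
  have hTarr : HoldsArray σ'.mem (area n 1) fun c => (A.boyRank c (T c) : ℕ) := fun c => by
    rw [hd'.2.2.1 c, hTp c]
  have hbefore := eval_girlBeforeE_pos hd'.1 hTarr (hB 1) hp.2.1 hp.2.2.2
  have hnf : (failE (areaE 1)).eval n σ' = 0 := Nat.eq_zero_of_not_pos fun h => by
    obtain ⟨c, hc⟩ := hfail.1 h
    exact absurd (hlt c) (not_lt.2 hc)
  rw [hnf, Nat.zero_add]
  by_cases hTl : (A.girlRank g (T.symm g) : ℕ) < l
  · rw [if_pos (hbefore.2 hTl), run_seq]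
    have hw : window A b k g l = ∅ := by
      ext M
      simp only [Set.mem_empty_iff_false, iff_false]
      rintro ⟨m1, m2, m3⟩
      have m4 := Fin.le_def.1 ((hT.2 M ⟨m1, m2⟩).girlRank_le m1 g)
      omega
    have hnone := isTheRotationOf_none_of_eq_empty hw
    exact ⟨none, none, hnone.1, hnone.2, comb _ _ _ _ writes_noneS writes_noneS⟩
  rw [if_neg fun h => hTl (hbefore.1 h), run_seq]
  -- the rotation into the window
  have hin : ∃ ρ, IsTheRotationOf (rotationsInto A (window A b k g l)) ρ ∧
      Writes σ' ((Stmt.ite (posE (areaE 0) 0) (.var 2)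
          (.seq (.assign 11 (partnerE (areaE 1) 0)) (dualOrbitS (areaE 1))) noneS).run n σ') ρ := by
    rw [run_ite, eval_posE hd'.2.1 (hB 0) hp.1, Expr.eval, hp.2.2.1]
    rcases finalPositions_spec (A := A) (b := b) (k := 0) (g := g) (l := n) with
      ⟨-, N, hN, hNp⟩ | ⟨-, hempty⟩
    swap
    · rw [constrained_size] at hempty
      exact absurd (hempty ▸ (show T ∈ {M | M ∈ A.stableMatchings ∧ 0 ≤ _} from
        ⟨hT.1.1, Nat.zero_le (A.boyRank b (T b) : ℕ)⟩)) (Set.notMem_empty T)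
    rw [constrained_size] at hN
    by_cases hlt : (A.boyRank b (N b) : ℕ) < k
    · obtain ⟨-, hc, hr⟩ := isTheRotationOf_rotationsInto_dualOrbit (l := l) (g := g) hT
        (not_lt.1 hTl) hN.1.1 (hN.2 T ⟨hT.1.1, Nat.zero_le _⟩) hlt
      refine ⟨_, hr, ?_⟩
      rw [if_pos (by rwa [hNp])]
      refine writes_dualOrbitS hd'.1 hTarr (by omega) hc ?_
      rw [eval_partnerE hd'.1 hTarr (hB 1) (by omega) hp.1 (Fin.is_lt _)]
      exact congrArg _ (boyList_boyRank b (T b))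
    · rw [if_neg (by rwa [hNp])]
      refine ⟨none, isTheRotationOf_rotationsInto_none fun M hM => ?_, writes_noneS⟩
      exact (not_lt.1 hlt).trans (hN.2 M ⟨hM, Nat.zero_le _⟩ b)
  obtain ⟨ρ, hρ, hw⟩ := hin
  set τ := (Stmt.ite (posE (areaE 0) 0) (.var 2)
    (.seq (.assign 11 (partnerE (areaE 1) 0)) (dualOrbitS (areaE 1))) noneS).run n σ'
  have hpτ : HoldsParams τ b k g l := hp.congr fun x hx => hw.1 x (by omega)
  have hdτ : HoldsData A b k g l τ.mem := hd'.congr (h14 ▸ hw.2.1)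
  have hτ14 : area n 3 ≤ τ.reg 14 := by
    rw [hw.2.2.2.1, h14]
    exact Nat.le_add_right _ _
  -- the rotation out of the window
  have hout : ∃ ρ, IsTheRotationOf (rotationsOutOf A (window A b k g l)) ρ ∧
      Writes τ ((Stmt.ite (.const 0) (failE (areaE 2)) noneS
          (.seq (.assign 11 (.var 1)) (dualOrbitS (areaE 2)))).run n τ) ρ := by
    have hfail : 0 < (failE (areaE 2)).eval n τ ↔ _ := eval_failE_pos hdτ.2.2.2 (hB 2)
    rw [run_ite, Expr.eval]
    rcases finalPositions_spec (A := A) (b := b) (k := k) (g := g) (l := l) with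
      ⟨hlt, T', hT', hTp'⟩ | ⟨hge, hempty⟩
    · rw [if_neg]
      swap
      · intro h
        obtain ⟨c, hc⟩ := hfail.1 h
        exact absurd (hlt c) (not_lt.2 hc)
      obtain ⟨-, hc, hr⟩ := isTheRotationOf_rotationsOutOf_dualOrbit hT' hT.1.1 hT.1.2
        (not_lt.1 hTl) (hT.2 T' ⟨hT'.1.1, hT'.1.2.1⟩)
      exact ⟨_, hr, writes_dualOrbitS hdτ.1
        (fun c => by rw [hdτ.2.2.2 c, hTp' c]) (by omega) hc hpτ.2.1⟩
    · rw [if_pos (hfail.2 hge)]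
      refine ⟨none, isTheRotationOf_rotationsOutOf_none fun M m1 m2 => ?_, writes_noneS⟩
      by_contra! m3
      exact Set.notMem_empty M (hempty ▸ (show M ∈ constrained A b k g l from ⟨m1, m2, m3⟩))
  obtain ⟨ρ', hρ', hw'⟩ := hout
  exact ⟨ρ, ρ', hρ, hρ', comb _ _ _ _ hw hw'⟩

/-- Copy the next cell of the output to its final place. -/
def copyCellS : Stmt :=
  .seq (.store (.var 17) (.mem (.add (.var 17) (areaE 3))))
    (.assign 17 (.add (.var 17) (.const 1)))

/-- Copy the output to its final place. -/
def copyS : Stmt :=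
  .seq (.assign 17 (.const 0)) (.loop 16
    (.seq copyCellS (.seq copyCellS (.seq copyCellS (.seq copyCellS copyCellS)))))

/-- The first `s` cells have been copied. -/
def Copied (n s : ℕ) (σ τ : State) : Prop :=
  τ.reg 17 = s ∧ (∀ a < s, τ.mem a = σ.mem (area n 3 + a)) ∧ ∀ a, s ≤ a → τ.mem a = σ.mem a

theorem run_copyCellS {s : ℕ} (h : Copied n s σ τ) : Copied n (s + 1) σ (copyCellS.run n τ) := by
  obtain ⟨h1, h2, h3⟩ := h
  have h4 : (areaE 3).eval n τ = area n 3 := eval_areaE 3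
  simp only [copyCellS, run_seq, run_store, run_assign, Expr.eval, h1, h4]
  refine ⟨by simp [State.setReg_reg, h1], fun a ha => ?_, fun a ha => ?_⟩
  · rw [State.setReg_mem, State.setMem_mem]
    split_ifs with e
    · rw [h3 _ (by omega), e, Nat.add_comm]
    · exact h2 a (by omega)
  · rw [State.setReg_mem, State.setMem_mem, if_neg (by omega), h3 a (by omega)]

theorem run_copyS {a : ℕ} (ha : a < 5 * n) : (copyS.run n σ).mem a = σ.mem (area n 3 + a) := by
  obtain ⟨υ, hυ, e⟩ := run_loop (n := n) (x := 16)
    (s := .seq copyCellS (.seq copyCellS (.seq copyCellS (.seq copyCellS copyCellS))))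
    (σ := σ.setReg 17 0) (fun i υ => Copied n (5 * i) σ υ)
    ⟨by simp [State.setReg_reg], fun a ha => by omega, fun _ _ => rfl⟩
    (fun i hi υ hυ => by
      simp only [run_seq]
      have h0 : Copied n (5 * i) σ (υ.setReg 16 i) :=
        ⟨by simp [State.setReg_reg, hυ.1], hυ.2.1, hυ.2.2⟩
      exact run_copyCellS (run_copyCellS (run_copyCellS (run_copyCellS (run_copyCellS h0)))))
  rw [copyS, run_seq, run_assign, Expr.eval, e]
  exact hυ.2.1 a ha

/-- The whole algorithm. -/
def mainS : Stmt := .seq paramsS (.seq arraysS (.seq rotationsS copyS))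

theorem run_mainS (A : SMInstance n) (s : Shift n) :
    ∃ ρin ρout : Option (List (Fin n × Fin n)),
      IsTheRotationOf (rotationsInto A (lostMatchings A (A.applyShift s))) ρin ∧
      IsTheRotationOf (rotationsOutOf A (lostMatchings A (A.applyShift s))) ρout ∧
      (mainS.run n (State.init (encodeInput A s))).Holds
        (encodeRotation ρin ++ encodeRotation ρout) := by
  have hn : 2 ≤ n := by
    rcases s with ⟨_, i, j, h⟩ | ⟨_, i, j, h⟩ <;>
    · have := j.2
      have := Fin.lt_def.1 h
      omega
  obtain ⟨b, k, g, l, hlost, hp, hm⟩ := run_paramsS A s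
  obtain ⟨hp', hd⟩ := run_arraysS (A := A) (hm ▸ holdsLists_init A s) hp fun a ha => by
    rw [hm]
    exact init_mem_eq_zero A s ((le_area n 0).trans ha)
  obtain ⟨ρin, ρout, h1, h2, h3, h4⟩ := run_rotationsS hp' hd
  rw [hlost]
  refine ⟨ρin, ρout, h1, h2, fun a ha => ?_⟩
  rw [mainS, run_seq, run_seq, run_seq, run_copyS (by omega)]
  exact h3 a ha

end StableMatching

theorem proposition3p7 :
    ∃ (P : RAM.Prog) (q : Polynomial ℕ),
      ∀ (n : ℕ) (A : StableMatching.SMInstance n) (s : StableMatching.Shift n),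
        ∃ ρin ρout : Option (List (Fin n × Fin n)),
          StableMatching.IsTheRotationOf
            (StableMatching.rotationsInto A
              (StableMatching.lostMatchings A (A.applyShift s))) ρin ∧
          StableMatching.IsTheRotationOf
            (StableMatching.rotationsOutOf A
              (StableMatching.lostMatchings A (A.applyShift s))) ρout ∧
          ∃ (t : ℕ) (σ : RAM.State),
            RAM.Exec P (RAM.State.init (StableMatching.encodeInput A s)) t σ ∧
            t ≤ q.eval n ∧
            σ.Holds (StableMatching.encodeRotation ρin ++
              StableMatching.encodeRotation ρout) := by
  obtain ⟨P, q, h⟩ := StableMatching.mainS.exists_prog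
  refine ⟨P, q, fun n A s => ?_⟩
  obtain ⟨ρin, ρout, h1, h2, h3⟩ := StableMatching.run_mainS A s
  obtain ⟨t, σ, he, ht, hm⟩ := h n _
  refine ⟨ρin, ρout, h1, h2, t, σ, he, ht, fun a ha => ?_⟩
  rw [hm]
  exact h3 a ha
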